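/- Let $0<q<1$, $\mu_1,\mu_2>0$, and let $t_1,t_2\in\mathbb C$ satisfy $t_1t_2=\mu_1\mu_2$ and, for every $m\in\mathbb Z$, $t_1\ne\mu_1q^m$, $t_1\neq\mu_2q^m$, $t_1\neq-q^m$, $t_2\ne-q^m$. Write $(a;q)_n=\prod_{k=0}^{n-1}(1-aq^k)$, $(a;q)_\infty=\lim_{n\to\infty}(a;q)_n$, $(a_1,\dots,a_r;q)_n=\prod_i(a_i;q)_n$ (also for $n=\infty$), $$ {}_3\varphi_2\!\left({a,b,c\atop d,e};q,z\right)=\sum_{k\ge0}\frac{(a,b,c;q)_k}{(d,e,q;q)_k}z^k ,\qquad \int_{-\mu_2}^{1}f(y)\,d_qy=(1-q)\sum_{k\ge0}q^kf(q^k)+\mu_2(1-q)\sum_{k\ge0}q^kf(-\mu_2q^k).$$ Let $G=\{q^s,\,-\mu_1q^s:\ s=0,1,2,\dots\}$. For $x\in G$ put $$u(x,y)={}_3\varphi_2\!\left({x^{-1},\,y^{-1},\,-q/t_1\atop q\mu_1/(t_1x),\ q\mu_2/(t_1y)};q,q\right)\ \text{ if } x=q^s,\qquad u(x,y)={}_3\varphi_2\!\left({-\mu_1/x,\,-\mu_2/y,\,-qt_2\atop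 -qt_2/x,\ -qt_2/y};q,q\right)\ \text{ if } x=-\mu_1q^s,$$ and let $v(x,y)$ be obtained from $u(x,y)$ by interchanging $t_1$ and $t_2$. For $x,x'\in G$ let $$\tilde\rho(y)=\tilde\rho_{x,x'}(y)=\frac{(qy,\,-qy/\mu_2;q)_\infty}{D_{x,x'}(y)},$$ where $D_{x,x'}(y)$ equals $(t_1y/\mu_2,\,t_2y/\mu_2;q)_\infty$ if $x,x'>0$; $(-y/t_1,\,-y/t_2;q)_\infty$ if $x,x'<0$; $(t_1y/\mu_2,\,-y/t_1;q)_\infty$ if $x>0>x'$; and $(-y/t_2,\,t_2y/\mu_2;q)_\infty$ if $x<0<x'$. Let $$d_x^2=\frac{(q,q,-\mu_1,-\mu_2,-q/\mu_1,-q/\mu_2;q)_\infty}{(-t_1,-t_2,t_1/\mu_1,t_2/\mu_1,t_1/\mu_2,t_2/\mu_2;q)_\infty}\cdot\frac{(t_1x/\mu_1,\,t_2x/\mu_1;q)_\infty}{(qx,\,-qx/\mu_1;q)_\infty}\,|x|^{-1}\quad\text{if } x=q^s,$$ $$d_x^2=\frac{(q,q,-\mu_1,-\mu_2,-q/\mu_1,-q/\mu_2;q)_\infty}{(-1/t_1,-1/t_2,\mu_1/t_1,\mu_1/t_2,\mu_2/t_1,\mu_2/t_2;q)_\infty}\cdot\frac{(-x/t_1,\,-x/t_2;q)_\infty}{(qx,\,-qx/\mu_1;q)_\infty}\,|x|^{-1}\quad\text{if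 } x=-\mu_1q^s.$$ Then each of the two expressions that define $u$ is self-dual, that is, invariant under the simultaneous interchange $x\leftrightarrow y$, $\mu_1\leftrightarrow\mu_2$; and for all $x,x'\in G$ the $q$-integral below converges absolutely and $$\int_{-\mu_2}^{1}u(x,y)\,v(x',y)\,\tilde\rho(y)\,d_qy=(1-q)\,d_x^2\,\delta_{xx'} .$$ -/

import Mathlib

noncomputable section

namespace QBiorth

/-- The finite `q`-shifted factorial `(a; q)_n = ∏_{k < n} (1 - a q^k)`. -/
def qPoch (a q : ℂ) (n : ℕ) : ℂ := ∏ k ∈ Finset.range n, (1 - a * q ^ k)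

/-- The infinite `q`-shifted factorial `(a; q)_∞ = ∏_{k ≥ 0} (1 - a q^k)`, used for `|q| < 1`. -/
def qPochInf (a q : ℂ) : ℂ := ∏' k : ℕ, (1 - a * q ^ k)

/-- The basic hypergeometric series `₃φ₂(a, b, c; d, e; q, z)`. -/
def phi32 (a b c d e q z : ℂ) : ℂ :=
  ∑' k : ℕ, qPoch a q k * qPoch b q k * qPoch c q k /
    (qPoch d q k * qPoch e q k * qPoch q q k) * z ^ k

/-- Absolute convergence of the series that defines `∫_0^a f(y) d_q y`. -/
def JacksonIntegrableZero (q : ℝ) (f : ℝ → ℂ) (a : ℝ) : Prop :=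
  Summable fun k : ℕ => f (a * q ^ k) * ((q ^ k : ℝ) : ℂ)

/-- Jackson's `q`-integral `∫_0^a f(y) d_q y = a (1 - q) ∑_{k ≥ 0} f(a q^k) q^k`. -/
def jacksonZero (q : ℝ) (f : ℝ → ℂ) (a : ℝ) : ℂ :=
  ((a * (1 - q) : ℝ) : ℂ) * ∑' k : ℕ, f (a * q ^ k) * ((q ^ k : ℝ) : ℂ)

/-- Both series that define `∫_a^b f(y) d_q y` converge absolutely. -/
def JacksonIntegrable (q : ℝ) (f : ℝ → ℂ) (a b : ℝ) : Prop :=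
  JacksonIntegrableZero q f a ∧ JacksonIntegrableZero q f b

/-- Jackson's `q`-integral `∫_a^b f(y) d_q y = ∫_0^b f(y) d_q y - ∫_0^a f(y) d_q y`. -/
def jackson (q : ℝ) (f : ℝ → ℂ) (a b : ℝ) : ℂ :=
  jacksonZero q f b - jacksonZero q f a

/-- The grid `{q^s, -μ q^s : s = 0, 1, 2, …}`. -/
def grid (q μ : ℝ) : Set ℝ := {x | ∃ s : ℕ, x = q ^ s ∨ x = -μ * q ^ s}

/-- The expression for the rational function used at `x = q^s`. -/
def uPos (q μ₁ μ₂ : ℝ) (t₁ : ℂ) (x y : ℝ) : ℂ :=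
  phi32 (x : ℂ)⁻¹ (y : ℂ)⁻¹ (-q / t₁) (q * μ₁ / (t₁ * x)) (q * μ₂ / (t₁ * y)) q q

/-- The expression for the rational function used at `x = -μ₁ q^s`. -/
def uNeg (q μ₁ μ₂ : ℝ) (t₂ : ℂ) (x y : ℝ) : ℂ :=
  phi32 (-μ₁ / x) (-μ₂ / y) (-q * t₂) (-q * t₂ / x) (-q * t₂ / y) q q

/-- The rational function `u(x, y)`. On the grid, `0 < x` singles out the points `x = q^s`
(`μ₁` is positive). -/
def u (q μ₁ μ₂ : ℝ) (t₁ t₂ : ℂ) (x y : ℝ) : ℂ :=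
  if 0 < x then uPos q μ₁ μ₂ t₁ x y else uNeg q μ₁ μ₂ t₂ x y

/-- The rational function `v(x, y)`: `u(x, y)` with `t₁` and `t₂` interchanged. -/
def v (q μ₁ μ₂ : ℝ) (t₁ t₂ : ℂ) (x y : ℝ) : ℂ := u q μ₁ μ₂ t₂ t₁ x y

/-- The weight `ρ̃(y)`, which depends on the branches of the grid that contain `x` and `x'`. -/
def weight (q μ₂ : ℝ) (t₁ t₂ : ℂ) (x x' y : ℝ) : ℂ :=
  qPochInf (q * y) q * qPochInf (-q * y / μ₂) q /
    (if 0 < x then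
      if 0 < x' then qPochInf (t₁ * y / μ₂) q * qPochInf (t₂ * y / μ₂) q
      else qPochInf (t₁ * y / μ₂) q * qPochInf (-y / t₁) q
    else
      if 0 < x' then qPochInf (-y / t₂) q * qPochInf (t₂ * y / μ₂) q
      else qPochInf (-y / t₁) q * qPochInf (-y / t₂) q)

/-- The squared norm `d_x²`. -/
def normSq (q μ₁ μ₂ : ℝ) (t₁ t₂ : ℂ) (x : ℝ) : ℂ :=
  if 0 < x then
    qPochInf q q * qPochInf q q * qPochInf (-μ₁) q * qPochInf (-μ₂) q *
        qPochInf (-q / μ₁) q * qPochInf (-q / μ₂) q /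
      (qPochInf (-t₁) q * qPochInf (-t₂) q * qPochInf (t₁ / μ₁) q * qPochInf (t₂ / μ₁) q *
        qPochInf (t₁ / μ₂) q * qPochInf (t₂ / μ₂) q) *
    (qPochInf (t₁ * x / μ₁) q * qPochInf (t₂ * x / μ₁) q /
      (qPochInf (q * x) q * qPochInf (-q * x / μ₁) q)) * ((|x|⁻¹ : ℝ) : ℂ)
  else
    qPochInf q q * qPochInf q q * qPochInf (-μ₁) q * qPochInf (-μ₂) q *
        qPochInf (-q / μ₁) q * qPochInf (-q / μ₂) q /
      (qPochInf (-1 / t₁) q * qPochInf (-1 / t₂) q * qPochInf (μ₁ / t₁) q * qPochInf (μ₁ / t₂) q *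
        qPochInf (μ₂ / t₁) q * qPochInf (μ₂ / t₂) q) *
    (qPochInf (-x / t₁) q * qPochInf (-x / t₂) q /
      (qPochInf (q * x) q * qPochInf (-q * x / μ₁) q)) * ((|x|⁻¹ : ℝ) : ℂ)

end QBiorth

end

open Filter Topology

noncomputable section

namespace QBiorth

/-! ### Finite `q`-shifted factorials -/

/-! The engine is the Andrews–Askey integral (`aaIntegral_eq`). Multiplying its integrand by a
factor `(A/y;q)_k / (B/y;q)_k` whose `A` is an endpoint and whose `B` matches a denominator
parameter only moves that endpoint by `q^k` and that parameter by `q^{-k}`, so every such moment has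
a closed form.

On the positive branch, `u` is a terminating sum of factors anchored at the endpoint `1`. Tested
against a factor of index `l` anchored at the other endpoint `-μ₂`, the moments form a balanced
`₃φ₂`; the balance is exactly `t₁t₂ = μ₁μ₂`. The `q`-Saalschütz sum turns it into a multiple of
`(q^{-l};q)_s`, which vanishes for `l < s` (`hasBilateral_rPos_mul_ratio`). A second use of
Saalschütz rewrites `v` at `x' = q^{s'}` through the factors at `-μ₂` with `l ≤ s'`
(`ratio_one_eq_sum`). For `s' ≤ s` only `l = s = s'` can survive, and it gives the norm
(`normPos_eq`); interchanging `t₁` and `t₂` covers `s ≤ s'`.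

For points on different branches each moment is an Andrews–Askey integral with `abcd = 1`, so its
numerator contains `(1;q)_∞ = 0` (`hasBilateral_pos_neg`). The negative branch is the positive one
after `y ↦ -μ₂y` and inversion of all parameters except `q` (`rNeg_eq_rPos`, `normNeg_eq`). -/

@[simp] lemma qPoch_zero (a q : ℂ) : qPoch a q 0 = 1 := by simp [qPoch]

lemma qPoch_succ (a q : ℂ) (n : ℕ) : qPoch a q (n + 1) = qPoch a q n * (1 - a * q ^ n) := by
  simp [qPoch, Finset.prod_range_succ]

lemma qPoch_add (a q : ℂ) (m n : ℕ) :
    qPoch a q (m + n) = qPoch a q m * qPoch (a * q ^ m) q n := by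
  simp only [qPoch, Finset.prod_range_add]
  congr 1
  exact Finset.prod_congr rfl fun k _ => by ring

lemma qPoch_ne_zero {a q : ℂ} (h : ∀ k : ℕ, a * q ^ k ≠ 1) (n : ℕ) : qPoch a q n ≠ 0 :=
  Finset.prod_ne_zero_iff.2 fun k _ => sub_ne_zero.2 (h k).symm

lemma qPoch_eq_zero {a q : ℂ} {k n : ℕ} (h : a * q ^ k = 1) (hk : k < n) : qPoch a q n = 0 :=
  Finset.prod_eq_zero (Finset.mem_range.2 hk) (sub_eq_zero.2 h.symm)

/-- Reversing the order of the factors in a ratio of two shifted factorials. -/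
lemma qPoch_inv_div {q : ℂ} (hq : q ≠ 0) {A B y : ℂ} (hA : A ≠ 0) (hB : B ≠ 0) (hy : y ≠ 0)
    (k : ℕ) :
    qPoch (A / y) q k / qPoch (B / y) q k =
      (A / B) ^ k * (qPoch (y * q / A / q ^ k) q k / qPoch (y * q / B / q ^ k) q k) := by
  -- Each factor of the reversed product pulls out `-A/y` times a power of `q`. The part independent
  -- of `A` cancels in the ratio, which needs no nonvanishing of the shifted factorials themselves.
  have key : ∀ A : ℂ, A ≠ 0 → qPoch (A / y) q k =
      (-A / y) ^ k * (∏ j ∈ Finset.range k, q ^ j) * qPoch (y * q / A / q ^ k) q k := by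
    intro A hA
    rw [qPoch, qPoch, ← Finset.prod_range_reflect (fun j => 1 - y * q / A / q ^ k * q ^ j) k,
      show (-A / y) ^ k = ∏ _j ∈ Finset.range k, (-A / y) by simp [div_pow], ← Finset.prod_mul_distrib,
      ← Finset.prod_mul_distrib]
    refine Finset.prod_congr rfl fun j hj => ?_
    have hj : j < k := Finset.mem_range.1 hj
    obtain ⟨m, rfl⟩ : ∃ m, k = j + 1 + m := ⟨k - (j + 1), by omega⟩
    rw [show j + 1 + m - 1 - j = m by omega]
    field_simp
    ring
  have hP : (∏ j ∈ Finset.range k, q ^ j) ≠ 0 := Finset.prod_ne_zero_iff.2 fun j _ => pow_ne_zero _ hq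
  have hyk : (1 / y) ^ k ≠ 0 := pow_ne_zero _ (one_div_ne_zero hy)
  rw [key A hA, key B hB, show -A / y = A * (-1) * (1 / y) by ring,
    show -B / y = B * (-1) * (1 / y) by ring, mul_pow, mul_pow, mul_pow, mul_pow, div_pow A B]
  have h1 : ((-1 : ℂ)) ^ k ≠ 0 := pow_ne_zero _ (by norm_num)
  have hBk : B ^ k ≠ 0 := pow_ne_zero _ hB
  rw [show A ^ k * (-1) ^ k * (1 / y) ^ k * (∏ j ∈ Finset.range k, q ^ j) *
      qPoch (y * q / A / q ^ k) q k = ((-1) ^ k * (1 / y) ^ k * (∏ j ∈ Finset.range k, q ^ j)) *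
      (A ^ k * qPoch (y * q / A / q ^ k) q k) by ring,
    show B ^ k * (-1) ^ k * (1 / y) ^ k * (∏ j ∈ Finset.range k, q ^ j) *
      qPoch (y * q / B / q ^ k) q k = ((-1) ^ k * (1 / y) ^ k * (∏ j ∈ Finset.range k, q ^ j)) *
      (B ^ k * qPoch (y * q / B / q ^ k) q k) by ring,
    mul_div_mul_left _ _ (mul_ne_zero (mul_ne_zero h1 hyk) hP), mul_div_mul_comm]

/-- `qPoch_inv_div`, solved for the shifted factorials with the lowered base point. -/
lemma qPoch_lower_div {q : ℂ} (hq : q ≠ 0) {x y : ℂ} (hx : x ≠ 0) (hy : y ≠ 0) (k : ℕ) :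
    qPoch (x / q ^ k) q k / qPoch (y / q ^ k) q k =
      (x / y) ^ k * (qPoch (q / x) q k / qPoch (q / y) q k) := by
  have h := qPoch_inv_div hq (div_ne_zero hq hx) (div_ne_zero hq hy) one_ne_zero k
  simp only [div_one, one_mul] at h
  rw [h, ← mul_assoc, ← mul_pow, show x / y * (q / x / (q / y)) = 1 by field_simp,
    show q / (q / x) = x by field_simp, show q / (q / y) = y by field_simp, one_pow, one_mul]

/-! ### Infinite `q`-shifted factorials -/

section
variable {q : ℂ} (hq : ‖q‖ < 1)
include hq

lemma summable_norm_mul_pow (a : ℂ) : Summable fun k : ℕ => ‖-(a * q ^ k)‖ := by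
  simp only [norm_neg, norm_mul, norm_pow]
  exact (summable_geometric_of_lt_one (norm_nonneg _) hq).mul_left _

lemma multipliable_qPoch (a : ℂ) : Multipliable fun k : ℕ => 1 - a * q ^ k := by
  simpa only [sub_eq_add_neg] using multipliable_one_add_of_summable (summable_norm_mul_pow hq a)

lemma tendsto_qPoch (a : ℂ) : Tendsto (qPoch a q) atTop (𝓝 (qPochInf a q)) :=
  (multipliable_qPoch hq a).tendsto_prod_tprod_nat

lemma norm_qPoch_sub_one_le (a : ℂ) (n : ℕ) :
    ‖qPoch a q n - 1‖ ≤ Real.exp (‖a‖ * (1 - ‖q‖)⁻¹) - 1 := by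
  have h := Finset.norm_prod_one_add_sub_one_le (Finset.range n) fun k => -(a * q ^ k)
  simp only [← sub_eq_add_neg] at h
  refine h.trans (sub_le_sub_right (Real.exp_le_exp.2 ?_) 1)
  refine ((summable_norm_mul_pow hq a).sum_le_tsum _ fun _ _ => norm_nonneg _).trans_eq ?_
  simp only [norm_neg, norm_mul, norm_pow]
  rw [tsum_mul_left, tsum_geometric_of_lt_one (norm_nonneg _) hq]

lemma norm_qPoch_le (a : ℂ) (n : ℕ) : ‖qPoch a q n‖ ≤ Real.exp (‖a‖ * (1 - ‖q‖)⁻¹) := by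
  have h1 := norm_qPoch_sub_one_le hq a n
  have h2 := norm_le_norm_sub_add (qPoch a q n) 1
  rw [norm_one] at h2
  linarith

lemma norm_qPochInf_sub_one_le (a : ℂ) :
    ‖qPochInf a q - 1‖ ≤ Real.exp (‖a‖ * (1 - ‖q‖)⁻¹) - 1 :=
  le_of_tendsto (((tendsto_qPoch hq a).sub_const 1).norm)
    (Eventually.of_forall fun n => norm_qPoch_sub_one_le hq a n)

lemma tendsto_qPochInf_mul_pow (a : ℂ) :
    Tendsto (fun n : ℕ => qPochInf (a * q ^ n) q) atTop (𝓝 1) := by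
  rw [tendsto_iff_norm_sub_tendsto_zero]
  refine squeeze_zero (fun _ => norm_nonneg _) (fun n => norm_qPochInf_sub_one_le hq _) ?_
  have h0 : Tendsto (fun n : ℕ => a * q ^ n) atTop (𝓝 (a * 0)) :=
    (tendsto_pow_atTop_nhds_zero_of_norm_lt_one hq).const_mul a
  have h1 : Continuous fun z : ℂ => Real.exp (‖z‖ * (1 - ‖q‖)⁻¹) - 1 := by fun_prop
  have h2 := (h1.tendsto _).comp h0
  rw [mul_zero, norm_zero, zero_mul, Real.exp_zero, sub_self] at h2
  exact h2

lemma qPochInf_eq_mul (a : ℂ) (n : ℕ) :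
    qPochInf a q = qPoch a q n * qPochInf (a * q ^ n) q := by
  have he : (fun k : ℕ => 1 - a * q ^ (k + n)) = fun k : ℕ => 1 - a * q ^ n * q ^ k := by
    funext k
    ring
  have h : Multipliable fun k : ℕ => 1 - a * q ^ (k + n) := he ▸ multipliable_qPoch hq (a * q ^ n)
  have h2 := h.prod_mul_tprod_nat_mul' (f := fun k : ℕ => 1 - a * q ^ k)
  rw [he] at h2
  exact h2.symm

lemma qPochInf_eq_mul_one (a : ℂ) : qPochInf a q = (1 - a) * qPochInf (a * q) q := by
  simpa [qPoch] using qPochInf_eq_mul hq a 1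

lemma qPochInf_ne_zero {a : ℂ} (h : ∀ k : ℕ, a * q ^ k ≠ 1) : qPochInf a q ≠ 0 := by
  have := tprod_one_add_ne_zero_of_summable (f := fun k : ℕ => -(a * q ^ k))
    (fun k => by rw [← sub_eq_add_neg]; exact sub_ne_zero.2 (h k).symm) (summable_norm_mul_pow hq a)
  simpa only [qPochInf, ← sub_eq_add_neg] using this

lemma qPochInf_eq_zero {a : ℂ} {k : ℕ} (h : a * q ^ k = 1) : qPochInf a q = 0 := by
  rw [qPochInf_eq_mul hq a (k + 1), qPoch_eq_zero h (Nat.lt_succ_self k), zero_mul]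

lemma qPochInf_self_ne_zero : qPochInf q q ≠ 0 := by
  refine qPochInf_ne_zero hq fun k h => ?_
  have h1 : ‖q‖ ^ (k + 1) = 1 := by rw [← norm_pow, pow_succ', h, norm_one]
  exact (pow_lt_one₀ (norm_nonneg q) hq k.succ_ne_zero).ne h1

lemma qPoch_self_ne_zero (n : ℕ) : qPoch q q n ≠ 0 := by
  have := qPochInf_self_ne_zero hq
  rw [qPochInf_eq_mul hq q n] at this
  exact left_ne_zero_of_mul this

end

@[simp] lemma qPochInf_zero (q : ℂ) : qPochInf 0 q = 1 := by simp [qPochInf]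

/-! ### The Andrews–Askey `q`-beta integral -/

/-- The integrand `(qy/a, qy/b; q)_∞ / (cy, dy; q)_∞` of the Andrews–Askey integral. -/
def aaWeight (q a b c d y : ℂ) : ℂ :=
  qPochInf (y * q / a) q * qPochInf (y * q / b) q / (qPochInf (c * y) q * qPochInf (d * y) q)

/-- The series `∑ f(x q^n) q^n` for the Andrews–Askey integrand. -/
def aaHalf (q a b c d x : ℂ) : ℂ := ∑' n : ℕ, aaWeight q a b c d (x * q ^ n) * q ^ n

/-- The Andrews–Askey integral from `a` to `b`, without the factor `1 - q`. -/
def aaIntegral (q a b c d : ℂ) : ℂ := b * aaHalf q a b c d b - a * aaHalf q a b c d a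

lemma aaIntegral_comm (q a b c d : ℂ) : aaIntegral q a b c d = aaIntegral q a b d c := by
  simp only [aaIntegral, aaHalf, aaWeight, mul_comm (qPochInf (c * _) q)]

section
variable {q : ℂ} (hq0 : q ≠ 0) (hq : ‖q‖ < 1) {a b c d x : ℂ}
include hq

lemma tendsto_aaWeight : Tendsto (fun n : ℕ => aaWeight q a b c d (x * q ^ n)) atTop (𝓝 1) := by
  have h : ∀ z : ℂ, Tendsto (fun n : ℕ => qPochInf (z * x * q ^ n) q) atTop (𝓝 1) :=
    fun z => tendsto_qPochInf_mul_pow hq _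
  have := ((h (q / a)).mul (h (q / b))).div ((h c).mul (h d)) (by simp)
  simp only [mul_one, div_one] at this
  refine this.congr fun n => ?_
  simp only [aaWeight, Pi.div_apply]
  congr 3 <;> ring

lemma summable_norm_aaWeight : Summable fun n : ℕ => ‖aaWeight q a b c d (x * q ^ n) * q ^ n‖ := by
  obtain ⟨C, hC⟩ := (Metric.isBounded_range_of_tendsto _
    (tendsto_aaWeight hq (a := a) (b := b) (c := c) (d := d) (x := x))).exists_norm_le
  refine Summable.of_nonneg_of_le (fun _ => norm_nonneg _) (fun n => ?_)
    ((summable_geometric_of_lt_one (norm_nonneg q) hq).mul_left C)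
  rw [norm_mul, norm_pow]
  exact mul_le_mul_of_nonneg_right (hC _ ⟨n, rfl⟩) (by positivity)

lemma hasSum_aaWeight :
    HasSum (fun n : ℕ => aaWeight q a b c d (x * q ^ n) * q ^ n) (aaHalf q a b c d x) :=
  (summable_norm_aaWeight hq).of_norm.hasSum

/-- The contiguous relation in `c` for half of the integral, by telescoping. -/
lemma aaHalf_step (ha : a ≠ 0) (hb : b ≠ 0) (hx0 : x ≠ 0) (hx : x = a ∨ x = b)
    (hc : ∀ n : ℕ, c * x * q ^ n ≠ 1) (hd : ∀ n : ℕ, d * x * q ^ n ≠ 1) :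
    (1 - a * c) * (1 - b * c) * (x * aaHalf q a b c d x) -
      (1 - a * b * c * d) * (x * aaHalf q a b (c * q) d x) = -(a * b * c) := by
  -- The telescoping antiderivative: the integrand with both numerator arguments lowered by one
  -- factor `q`. It starts at `0`, since one numerator is `(1;q)_∞` at an endpoint, and tends to
  -- `1`.
  set g : ℕ → ℂ := fun n => qPochInf (1 / a * x * q ^ n) q * qPochInf (1 / b * x * q ^ n) q /
    (qPochInf (c * x * q ^ n) q * qPochInf (d * x * q ^ n) q) with hg
  have hterm : ∀ n : ℕ, (1 - a * c) * (1 - b * c) * (x * (aaWeight q a b c d (x * q ^ n) * q ^ n)) -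
      (1 - a * b * c * d) * (x * (aaWeight q a b (c * q) d (x * q ^ n) * q ^ n)) =
      a * b * c * (g n - g (n + 1)) := by
    intro n
    have hcn := sub_ne_zero.2 (hc n).symm
    have hdn := sub_ne_zero.2 (hd n).symm
    have hC : qPochInf (c * x * q ^ n * q) q ≠ 0 := qPochInf_ne_zero hq fun k => by
      simpa [pow_add, mul_assoc, mul_comm, mul_left_comm] using hc (n + 1 + k)
    have hD : qPochInf (d * x * q ^ n * q) q ≠ 0 := qPochInf_ne_zero hq fun k => by
      simpa [pow_add, mul_assoc, mul_comm, mul_left_comm] using hd (n + 1 + k)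
    simp only [hg, aaWeight, pow_succ]
    rw [qPochInf_eq_mul_one hq (1 / a * x * q ^ n), qPochInf_eq_mul_one hq (1 / b * x * q ^ n),
      qPochInf_eq_mul_one hq (c * x * q ^ n), qPochInf_eq_mul_one hq (d * x * q ^ n),
      show x * q ^ n * q / a = 1 / a * x * q ^ n * q by ring,
      show x * q ^ n * q / b = 1 / b * x * q ^ n * q by ring,
      show c * (x * q ^ n) = c * x * q ^ n by ring, show d * (x * q ^ n) = d * x * q ^ n by ring,
      show c * q * (x * q ^ n) = c * x * q ^ n * q by ring,
      show 1 / a * x * (q ^ n * q) = 1 / a * x * q ^ n * q by ring,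
      show 1 / b * x * (q ^ n * q) = 1 / b * x * q ^ n * q by ring,
      show c * x * (q ^ n * q) = c * x * q ^ n * q by ring,
      show d * x * (q ^ n * q) = d * x * q ^ n * q by ring,
      qPochInf_eq_mul_one hq (c * x * q ^ n), qPochInf_eq_mul_one hq (d * x * q ^ n)]
    generalize qPochInf (1 / a * x * q ^ n * q) q = A
    generalize qPochInf (1 / b * x * q ^ n * q) q = B
    generalize qPochInf (c * x * q ^ n * q) q = C at hC ⊢
    generalize qPochInf (d * x * q ^ n * q) q = D at hD ⊢
    generalize q ^ n = Q at *
    have hcn' : 1 - x * Q * c ≠ 0 := by rwa [mul_comm, ← mul_assoc]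
    have hdn' : 1 - x * Q * d ≠ 0 := by rwa [mul_comm, ← mul_assoc]
    field_simp
    ring
  have hg0 : g 0 = 0 := by
    have h1 : qPochInf 1 q = 0 := qPochInf_eq_zero hq (k := 0) (by simp)
    rcases hx with rfl | rfl
    · simp [hg, hx0, h1]
    · simp [hg, hx0, h1]
  have hglim : Tendsto g atTop (𝓝 1) := by
    have h : ∀ z : ℂ, Tendsto (fun n : ℕ => qPochInf (z * x * q ^ n) q) atTop (𝓝 1) :=
      fun z => tendsto_qPochInf_mul_pow hq _
    have := ((h (1 / a)).mul (h (1 / b))).div ((h c).mul (h d)) (by simp)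
    simp only [mul_one, div_one] at this
    exact this
  have hS := (((hasSum_aaWeight hq (a := a) (b := b) (c := c) (d := d) (x := x)).mul_left x).mul_left
    ((1 - a * c) * (1 - b * c))).sub
    (((hasSum_aaWeight hq (a := a) (b := b) (c := c * q) (d := d) (x := x)).mul_left x).mul_left
    (1 - a * b * c * d))
  refine tendsto_nhds_unique hS.tendsto_sum_nat ?_
  have : ∀ N : ℕ, ∑ n ∈ Finset.range N,
      ((1 - a * c) * (1 - b * c) * (x * (aaWeight q a b c d (x * q ^ n) * q ^ n)) -
      (1 - a * b * c * d) * (x * (aaWeight q a b (c * q) d (x * q ^ n) * q ^ n))) =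
      a * b * c * (0 - g N) := by
    intro N
    rw [Finset.sum_congr rfl fun n _ => hterm n, ← Finset.mul_sum, Finset.sum_range_sub', hg0]
  simp only [this]
  have h2 := (hglim.const_sub 0).const_mul (a * b * c)
  rwa [show a * b * c * (0 - 1) = -(a * b * c) by ring] at h2

/-- The boundary term `-abc` of `aaHalf_step` is the same at both endpoints, so it drops out of the
difference. -/
lemma aaIntegral_step (ha : a ≠ 0) (hb : b ≠ 0)
    (hac : ∀ n : ℕ, c * a * q ^ n ≠ 1) (had : ∀ n : ℕ, d * a * q ^ n ≠ 1)
    (hbc : ∀ n : ℕ, c * b * q ^ n ≠ 1) (hbd : ∀ n : ℕ, d * b * q ^ n ≠ 1) :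
    (1 - a * c) * (1 - b * c) * aaIntegral q a b c d =
      (1 - a * b * c * d) * aaIntegral q a b (c * q) d := by
  have h1 := aaHalf_step hq ha hb ha (Or.inl rfl) hac had
  have h2 := aaHalf_step hq ha hb hb (Or.inr rfl) hbc hbd
  unfold aaIntegral
  linear_combination h2 - h1

lemma aaIntegral_iterate (ha : a ≠ 0) (hb : b ≠ 0)
    (hac : ∀ n : ℕ, c * a * q ^ n ≠ 1) (had : ∀ n : ℕ, d * a * q ^ n ≠ 1)
    (hbc : ∀ n : ℕ, c * b * q ^ n ≠ 1) (hbd : ∀ n : ℕ, d * b * q ^ n ≠ 1) (N : ℕ) :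
    qPoch (a * c) q N * qPoch (b * c) q N * aaIntegral q a b c d =
      qPoch (a * b * c * d) q N * aaIntegral q a b (c * q ^ N) d := by
  induction N with
  | zero => simp
  | succ N ih =>
    have h := aaIntegral_step hq (c := c * q ^ N) ha hb
      (fun n => by simpa [pow_add, mul_assoc, mul_comm, mul_left_comm] using hac (N + n)) had
      (fun n => by simpa [pow_add, mul_assoc, mul_comm, mul_left_comm] using hbc (N + n)) hbd
    rw [mul_assoc c] at h
    simp only [qPoch_succ, pow_succ]
    linear_combination (1 - a * c * q ^ N) * (1 - b * c * q ^ N) * ih +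
      qPoch (a * b * c * d) q N * h

/-- Dominated convergence: passing from `c` to `c q^N` multiplies the integrand by `(cy;q)_N`, which
is bounded uniformly in `N` and in the grid point. -/
lemma tendsto_aaHalf (hc : ∀ n : ℕ, c * x * q ^ n ≠ 1) :
    Tendsto (fun N : ℕ => aaHalf q a b (c * q ^ N) d x) atTop (𝓝 (aaHalf q a b 0 d x)) := by
  have hne : ∀ n : ℕ, qPochInf (c * (x * q ^ n)) q ≠ 0 := fun n => qPochInf_ne_zero hq fun k => by
    simpa [pow_add, mul_assoc, mul_comm, mul_left_comm] using hc (n + k)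
  have hw : ∀ N n : ℕ, aaWeight q a b (c * q ^ N) d (x * q ^ n) =
      qPoch (c * (x * q ^ n)) q N * aaWeight q a b c d (x * q ^ n) := by
    intro N n
    have h := qPochInf_eq_mul hq (c * (x * q ^ n)) N
    have h0 := hne n
    rw [h] at h0
    simp only [aaWeight]
    rw [h, show c * q ^ N * (x * q ^ n) = c * (x * q ^ n) * q ^ N by ring]
    have h1 := left_ne_zero_of_mul h0
    generalize qPoch (c * (x * q ^ n)) q N = P at *
    rw [mul_assoc P, ← mul_div_assoc, mul_div_mul_left _ _ h1]
  refine tendsto_tsum_of_dominated_convergence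
    (bound := fun n => Real.exp (‖c * x‖ * (1 - ‖q‖)⁻¹) * ‖aaWeight q a b c d (x * q ^ n) * q ^ n‖)
    ((summable_norm_aaWeight hq).mul_left _) (fun n => ?_) (Eventually.of_forall fun N n => ?_)
  · simp only [hw]
    have h := ((tendsto_qPoch hq (c * (x * q ^ n))).mul_const
      (aaWeight q a b c d (x * q ^ n))).mul_const (q ^ n)
    convert h using 2
    have h0 := hne n
    simp only [aaWeight, zero_mul, qPochInf_zero, one_mul]
    rw [← mul_div_assoc, mul_div_mul_left _ _ h0]
  · rw [hw, mul_assoc, norm_mul]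
    refine mul_le_mul_of_nonneg_right ((norm_qPoch_le hq _ _).trans (Real.exp_le_exp.2 ?_))
      (norm_nonneg _)
    refine mul_le_mul_of_nonneg_right ?_ (inv_nonneg.2 (by linarith))
    rw [← mul_assoc, norm_mul (c * x), norm_pow]
    exact mul_le_of_le_one_right (norm_nonneg _) (pow_le_one₀ (norm_nonneg _) hq.le)

lemma aaIntegral_eq_zero_left (ha : a ≠ 0) (hb : b ≠ 0)
    (hac : ∀ n : ℕ, c * a * q ^ n ≠ 1) (had : ∀ n : ℕ, d * a * q ^ n ≠ 1)
    (hbc : ∀ n : ℕ, c * b * q ^ n ≠ 1) (hbd : ∀ n : ℕ, d * b * q ^ n ≠ 1) :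
    qPochInf (a * c) q * qPochInf (b * c) q * aaIntegral q a b c d =
      qPochInf (a * b * c * d) q * aaIntegral q a b 0 d := by
  refine tendsto_nhds_unique (((tendsto_qPoch hq _).mul (tendsto_qPoch hq _)).mul_const _) ?_
  simp only [aaIntegral_iterate hq ha hb hac had hbc hbd]
  exact (tendsto_qPoch hq _).mul (((tendsto_aaHalf hq hbc).const_mul b).sub
    ((tendsto_aaHalf hq hac).const_mul a))

/-- Sending first `c` and then `d` to zero isolates the whole dependence on them; what remains is a
constant depending only on `a`, `b`, `q`. -/
lemma aaIntegral_eq_zero_zero (ha : a ≠ 0) (hb : b ≠ 0)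
    (hac : ∀ n : ℕ, c * a * q ^ n ≠ 1) (had : ∀ n : ℕ, d * a * q ^ n ≠ 1)
    (hbc : ∀ n : ℕ, c * b * q ^ n ≠ 1) (hbd : ∀ n : ℕ, d * b * q ^ n ≠ 1) :
    qPochInf (a * c) q * qPochInf (a * d) q * qPochInf (b * c) q * qPochInf (b * d) q *
      aaIntegral q a b c d = qPochInf (a * b * c * d) q * aaIntegral q a b 0 0 := by
  have h1 := aaIntegral_eq_zero_left hq ha hb hac had hbc hbd
  have h2 := aaIntegral_eq_zero_left hq (c := d) (d := 0) ha hb had (by simp) hbd (by simp)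
  rw [aaIntegral_comm q a b d 0, mul_zero, qPochInf_zero] at h2
  linear_combination qPochInf (a * d) q * qPochInf (b * d) q * h1 + qPochInf (a * b * c * d) q * h2

include hq0

lemma aaIntegral_zero_zero (ha : a ≠ 0) (hb : b ≠ 0) (hab : ∀ n : ℕ, a * q ^ (n + 1) ≠ b)
    (hba : ∀ n : ℕ, b * q ^ (n + 1) ≠ a) :
    aaIntegral q a b 0 0 =
      b * (qPochInf q q * qPochInf (b * q / a) q * qPochInf (a / b) q) := by
  have hqn : ∀ n : ℕ, q ^ (n + 1) ≠ 1 := fun n h => by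
    have h1 : ‖q‖ ^ (n + 1) = 1 := by rw [← norm_pow, h, norm_one]
    exact (pow_lt_one₀ (norm_nonneg q) hq n.succ_ne_zero).ne h1
  have haa : ∀ n : ℕ, q / a * a * q ^ n ≠ 1 := fun n => by
    rw [div_mul_cancel₀ _ ha, ← pow_succ']; exact hqn n
  have hbb : ∀ n : ℕ, q / b * b * q ^ n ≠ 1 := fun n => by
    rw [div_mul_cancel₀ _ hb, ← pow_succ']; exact hqn n
  have hab' : ∀ n : ℕ, q / b * a * q ^ n ≠ 1 := fun n h => hab n (by
    field_simp at h
    rw [pow_succ, ← h]; ring)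
  have hba' : ∀ n : ℕ, q / a * b * q ^ n ≠ 1 := fun n h => hba n (by
    field_simp at h
    rw [pow_succ, ← h]; ring)
  -- The constant is found from the one choice of `c`, `d` for which the denominator equals the
  -- numerator: the integrand is then `1` and the integral is elementary.
  have h := aaIntegral_eq_zero_zero hq (c := q / a) (d := q / b) ha hb haa hab' hba' hbb
  have hhalf : ∀ x : ℂ, (∀ n : ℕ, q / a * x * q ^ n ≠ 1) → (∀ n : ℕ, q / b * x * q ^ n ≠ 1) →
      aaHalf q a b (q / a) (q / b) x = (1 - q)⁻¹ := by
    intro x h1 h2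
    rw [← tsum_geometric_of_norm_lt_one hq, aaHalf]
    refine tsum_congr fun n => ?_
    have e1 : qPochInf (q / a * (x * q ^ n)) q ≠ 0 := qPochInf_ne_zero hq fun k => by
      have := h1 (n + k)
      rwa [pow_add, ← mul_assoc, mul_assoc (q / a)] at this
    have e2 : qPochInf (q / b * (x * q ^ n)) q ≠ 0 := qPochInf_ne_zero hq fun k => by
      have := h2 (n + k)
      rwa [pow_add, ← mul_assoc, mul_assoc (q / b)] at this
    rw [aaWeight, show x * q ^ n * q / a = q / a * (x * q ^ n) by ring,
      show x * q ^ n * q / b = q / b * (x * q ^ n) by ring, div_self (mul_ne_zero e1 e2), one_mul]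
  have h1q : 1 - q ≠ 0 := sub_ne_zero.2 fun h => hqn 0 (by simp [← h])
  rw [aaIntegral, hhalf b hba' hbb, hhalf a haa hab', mul_div_cancel₀ _ ha, mul_div_cancel₀ _ hb,
    show a * b * (q / a) * (q / b) = q * q by field_simp] at h
  have hqq := qPochInf_self_ne_zero hq
  have e := qPochInf_eq_mul_one hq q
  -- The factor `1 - a/b` split off here absorbs the `b - a` of the elementary integral.
  have e2 := qPochInf_eq_mul_one hq (a / b)
  rw [e] at hqq
  have hqq2 := right_ne_zero_of_mul hqq
  rw [show a * (q / b) = a / b * q by ring, show b * (q / a) = b * q / a by ring, e] at h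
  rw [e2, e]
  apply mul_left_cancel₀ hqq2
  rw [← h]
  field_simp

/-- The Andrews–Askey integral. -/
theorem aaIntegral_eq (ha : a ≠ 0) (hb : b ≠ 0) (hab : ∀ n : ℕ, a * q ^ (n + 1) ≠ b)
    (hba : ∀ n : ℕ, b * q ^ (n + 1) ≠ a)
    (hac : ∀ n : ℕ, c * a * q ^ n ≠ 1) (had : ∀ n : ℕ, d * a * q ^ n ≠ 1)
    (hbc : ∀ n : ℕ, c * b * q ^ n ≠ 1) (hbd : ∀ n : ℕ, d * b * q ^ n ≠ 1) :
    aaIntegral q a b c d =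
      b * (qPochInf q q * qPochInf (b * q / a) q * qPochInf (a / b) q * qPochInf (a * b * c * d) q) /
      (qPochInf (a * c) q * qPochInf (a * d) q * qPochInf (b * c) q * qPochInf (b * d) q) := by
  have h := aaIntegral_eq_zero_zero hq ha hb hac had hbc hbd
  rw [aaIntegral_zero_zero hq0 hq ha hb hab hba] at h
  have n1 : qPochInf (a * c) q ≠ 0 := qPochInf_ne_zero hq fun k => by rw [mul_comm a]; exact hac k
  have n2 : qPochInf (a * d) q ≠ 0 := qPochInf_ne_zero hq fun k => by rw [mul_comm a]; exact had k
  have n3 : qPochInf (b * c) q ≠ 0 := qPochInf_ne_zero hq fun k => by rw [mul_comm b]; exact hbc k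
  have n4 : qPochInf (b * d) q ≠ 0 := qPochInf_ne_zero hq fun k => by rw [mul_comm b]; exact hbd k
  rw [eq_div_iff (by positivity)]
  linear_combination h

end

/-! ### The `q`-Saalschütz sum -/

section
variable {q a b c e : ℂ}

/-- With `n = m + j` fixed, this sums in closed form the first `m + 1` terms of the difference
expressing the recurrence in `n` for the convolution below. Induction on `m` needs all `j`, because
`m + 1 + j = m + (j + 1)`. -/
lemma qSaalschutz_telescope (hqn : ∀ n, qPoch q q n ≠ 0) (hcn : ∀ n, qPoch c q n ≠ 0)
    (ha : a ≠ 0) (hb : b ≠ 0) (he : c = e * a * b) (m j : ℕ) :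
    ∑ k ∈ Finset.range (m + 1),
      ((1 - c * q ^ (m + j)) * (1 - q ^ (m + j + 1)) * (qPoch a q k * qPoch b q k /
        (qPoch q q k * qPoch c q k) * e ^ k * (qPoch e q (m + j + 1 - k) / qPoch q q (m + j + 1 - k)))
      - (1 - c / a * q ^ (m + j)) * (1 - c / b * q ^ (m + j)) * (qPoch a q k * qPoch b q k /
        (qPoch q q k * qPoch c q k) * e ^ k * (qPoch e q (m + j - k) / qPoch q q (m + j - k)))) =
    -(q ^ j * (1 - a * q ^ m) * (1 - b * q ^ m) * (qPoch a q m * qPoch b q m /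
        (qPoch q q m * qPoch c q m)) * e ^ (m + 1) * (qPoch e q j / qPoch q q j)) := by
  have hca : c / a = e * b := by rw [he]; field_simp
  have hcb : c / b = e * a := by rw [he]; field_simp
  rw [hca, hcb]
  have hq1 : ∀ n, 1 - q * q ^ n ≠ 0 := fun n => by
    have := hqn (n + 1)
    rw [qPoch_succ] at this
    exact right_ne_zero_of_mul this
  have hc1 : ∀ n, 1 - c * q ^ n ≠ 0 := fun n => by
    have := hcn (n + 1)
    rw [qPoch_succ] at this
    exact right_ne_zero_of_mul this
  induction m generalizing j with
  | zero =>
    have h1 := hq1 j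
    have h2 := hqn j
    simp only [zero_add, Finset.range_one, Finset.sum_singleton, qPoch_zero, pow_zero, Nat.sub_zero,
      qPoch_succ, pow_succ']
    rw [he]
    generalize 1 - q * q ^ j = D at *
    field_simp
    ring
  | succ m ih =>
    rw [Finset.sum_range_succ, show m + 1 + j = m + (j + 1) by ring, ih (j + 1),
      show m + (j + 1) + 1 - (m + 1) = j + 1 by omega, show m + (j + 1) - (m + 1) = j by omega]
    have h1 := hq1 j
    have h2 := hqn j
    have h3 := hq1 m
    have h4 := hqn m
    have h5 := hc1 m
    have h6 := hcn m
    simp only [qPoch_succ, pow_succ', pow_add] at *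
    generalize qPoch a q m = A
    generalize qPoch b q m = B
    generalize qPoch c q m = C at *
    generalize qPoch q q m = Q at *
    generalize qPoch q q j = Q' at *
    generalize qPoch e q j = E
    generalize q ^ m = M at *
    generalize q ^ j = J at *
    subst he
    clear ih hqn hcn hq1 hc1 hca hcb
    generalize hD1 : 1 - q * J = D1 at *
    generalize hD3 : 1 - q * M = D3 at *
    generalize hD5 : 1 - e * a * b * M = D5 at *
    field_simp
    rw [← hD1, ← hD3, ← hD5]
    ring

/-- This is the coefficient of `z^n` in the `q`-analogue of Euler's transformation, `₂φ₁(c/a, c/b;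
c; z) = (ez;q)_∞/(z;q)_∞ · ₂φ₁(a, b; c; ez)`. It is proved by a first-order recurrence in `n`. -/
lemma qSaalschutz_conv (hqn : ∀ n, qPoch q q n ≠ 0) (hcn : ∀ n, qPoch c q n ≠ 0)
    (ha : a ≠ 0) (hb : b ≠ 0) (he : c = e * a * b) (n : ℕ) :
    ∑ k ∈ Finset.range (n + 1), qPoch a q k * qPoch b q k / (qPoch q q k * qPoch c q k) * e ^ k *
      (qPoch e q (n - k) / qPoch q q (n - k)) =
      qPoch (c / a) q n * qPoch (c / b) q n / (qPoch c q n * qPoch q q n) := by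
  induction n with
  | zero => simp
  | succ n ih =>
    -- At `j = 0` the telescoped right side is minus the missing term `k = n + 1` of the next
    -- convolution, up to the recurrence factor.
    have h := qSaalschutz_telescope hqn hcn ha hb he n 0
    simp only [add_zero] at h
    rw [Finset.sum_sub_distrib, ← Finset.mul_sum, ← Finset.mul_sum, ih] at h
    rw [Finset.sum_range_succ]
    have h1 := hqn (n + 1)
    have h2 := hcn (n + 1)
    have h3 := hqn n
    have h4 := hcn n
    generalize (∑ k ∈ Finset.range (n + 1), qPoch a q k * qPoch b q k / (qPoch q q k * qPoch c q k) *
      e ^ k * (qPoch e q (n + 1 - k) / qPoch q q (n + 1 - k))) = S at *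
    simp only [qPoch_succ, pow_succ', tsub_self, qPoch_zero, pow_zero, div_one, mul_one,
      one_mul] at *
    have h5 := right_ne_zero_of_mul h1
    have h6 := right_ne_zero_of_mul h2
    apply mul_left_cancel₀ (mul_ne_zero h6 h5)
    rw [mul_add, sub_eq_iff_eq_add.1 h]
    clear h ih h1 h2 hqn hcn
    generalize c / a = α
    generalize c / b = β
    generalize 1 - q * q ^ n = D1 at *
    generalize 1 - c * q ^ n = D3 at *
    field_simp
    ring

/-- The `q`-Saalschütz sum of a terminating balanced `₃φ₂`. -/
theorem qSaalschutz (hq : q ≠ 0) (hqn : ∀ n, qPoch q q n ≠ 0) (hcn : ∀ n, qPoch c q n ≠ 0)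
    (ha : a ≠ 0) (hb : b ≠ 0) (hc : c ≠ 0) {d : ℂ} {n : ℕ} (hd : c * d * q ^ n = a * b * q)
    (hen : qPoch (c / (a * b)) q n ≠ 0) :
    ∑ k ∈ Finset.range (n + 1), qPoch (q ^ n)⁻¹ q k * qPoch a q k * qPoch b q k /
      (qPoch c q k * qPoch d q k * qPoch q q k) * q ^ k =
      qPoch (c / a) q n * qPoch (c / b) q n / (qPoch c q n * qPoch (c / (a * b)) q n) := by
  set e := c / (a * b) with he
  have he0 : e ≠ 0 := div_ne_zero hc (mul_ne_zero ha hb)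
  have h := qSaalschutz_conv hqn hcn ha hb (e := e) (by rw [he]; field_simp) n
  have hqnn : q ^ n ≠ 0 := pow_ne_zero _ hq
  have hmul : qPoch (c / a) q n * qPoch (c / b) q n / (qPoch c q n * qPoch e q n) =
      qPoch q q n / qPoch e q n *
      (qPoch (c / a) q n * qPoch (c / b) q n / (qPoch c q n * qPoch q q n)) := by
    have := hqn n
    have := hcn n
    field_simp
  rw [hmul, ← h, Finset.mul_sum]
  refine Finset.sum_congr rfl fun k hk => ?_
  obtain ⟨j, rfl⟩ : ∃ j, n = j + k := ⟨n - k, by have := Finset.mem_range.1 hk; omega⟩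
  rw [Nat.add_sub_cancel]
  -- Reversal turns the convolution factor of index `n - k` into `(q^{-n};q)_k / (d;q)_k`; the
  -- relation for `d` is what makes `q/(e q^n)` equal to `d`.
  have hkey := qPoch_lower_div hq (x := q * q ^ (j + k)) (y := e * q ^ (j + k))
    (mul_ne_zero hq hqnn) (mul_ne_zero he0 hqnn) k
  have hqk : q ^ k ≠ 0 := pow_ne_zero _ hq
  rw [show q * q ^ (j + k) / q ^ k = q * q ^ j by rw [pow_add]; field_simp,
    show e * q ^ (j + k) / q ^ k = e * q ^ j by rw [pow_add]; field_simp,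
    show q / (q * q ^ (j + k)) = (q ^ (j + k))⁻¹ by field_simp,
    show q / (e * q ^ (j + k)) = d by
      rw [he]; field_simp; linear_combination -hd,
    show q * q ^ (j + k) / (e * q ^ (j + k)) = q / e by field_simp] at hkey
  have e1 := qPoch_add q q j k
  have e2 := qPoch_add e q j k
  have n1 := hqn (j + k)
  have n2 := hen
  rw [e2] at n2
  rw [e1] at n1
  have n3 := right_ne_zero_of_mul n1
  have n4 := right_ne_zero_of_mul n2
  have n5 := left_ne_zero_of_mul n1
  have n6 := left_ne_zero_of_mul n2
  rw [e1, e2]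
  clear_value e
  have hkey2 : qPoch (q ^ (j + k))⁻¹ q k / qPoch d q k * q ^ k =
      e ^ k * (qPoch (q * q ^ j) q k / qPoch (e * q ^ j) q k) := by
    rw [hkey, div_pow]
    field_simp
  rw [show qPoch (q ^ (j + k))⁻¹ q k * qPoch a q k * qPoch b q k /
      (qPoch c q k * qPoch d q k * qPoch q q k) * q ^ k = qPoch a q k * qPoch b q k /
      (qPoch c q k * qPoch q q k) * (qPoch (q ^ (j + k))⁻¹ q k / qPoch d q k * q ^ k) by ring, hkey2]
  have := hqn k
  have := hcn k
  generalize qPoch (e * q ^ j) q k = X1 at *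
  generalize qPoch (q * q ^ j) q k = X2 at *
  generalize qPoch a q k = X3
  generalize qPoch b q k = X4
  field_simp

end

/-! ### Bilateral `q`-integrals -/

/-- Both series of the `q`-integral of `f` from `-μ` to `1` converge, and the integral divided by
`1 - q` is `v`. -/
def HasBilateral (q μ : ℂ) (f : ℂ → ℂ) (v : ℂ) : Prop :=
  ∃ A B : ℂ, HasSum (fun n : ℕ => f (q ^ n) * q ^ n) A ∧
    HasSum (fun n : ℕ => f (-μ * q ^ n) * q ^ n) B ∧ v = A + μ * B

namespace HasBilateral

variable {q μ : ℂ} {f g : ℂ → ℂ} {v : ℂ}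

lemma congr (h : HasBilateral q μ f v) (h1 : ∀ n : ℕ, g (q ^ n) = f (q ^ n))
    (h2 : ∀ n : ℕ, g (-μ * q ^ n) = f (-μ * q ^ n)) : HasBilateral q μ g v := by
  obtain ⟨A, B, hA, hB, hv⟩ := h
  exact ⟨A, B, by simpa only [h1] using hA, by simpa only [h2] using hB, hv⟩

lemma const_mul (h : HasBilateral q μ f v) (c : ℂ) :
    HasBilateral q μ (fun y => c * f y) (c * v) := by
  obtain ⟨A, B, hA, hB, rfl⟩ := h
  exact ⟨c * A, c * B, by simpa only [mul_assoc] using hA.mul_left c,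
    by simpa only [mul_assoc] using hB.mul_left c, by ring⟩

lemma sum {ι : Type*} {s : Finset ι} {f : ι → ℂ → ℂ} {v : ι → ℂ}
    (h : ∀ i ∈ s, HasBilateral q μ (f i) (v i)) :
    HasBilateral q μ (fun y => ∑ i ∈ s, f i y) (∑ i ∈ s, v i) := by
  classical
  induction s using Finset.induction_on with
  | empty => exact ⟨0, 0, by simp, by simp, by simp⟩
  | insert i s hi ih =>
    obtain ⟨A, B, hA, hB, hv⟩ := h i (Finset.mem_insert_self i s)
    obtain ⟨A', B', hA', hB', hv'⟩ := ih fun j hj => h j (Finset.mem_insert_of_mem hj)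
    refine ⟨A + A', B + B', ?_, ?_, ?_⟩
    · simpa only [Finset.sum_insert hi, add_mul] using hA.add hA'
    · simpa only [Finset.sum_insert hi, add_mul] using hB.add hB'
    · rw [Finset.sum_insert hi, hv, hv']
      ring

/-- The substitution `y ↦ -μ y`. -/
lemma of_comp (hμ : μ ≠ 0) (h : HasBilateral q μ⁻¹ (fun y => f (-μ * y)) v) :
    HasBilateral q μ f (μ * v) := by
  obtain ⟨A, B, hA, hB, rfl⟩ := h
  refine ⟨B, A, ?_, hA, ?_⟩
  · convert hB using 4
    field_simp
  · field_simp
    ring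

end HasBilateral

/-- The factor `(A/y; q)_k / (B/y; q)_k`. -/
def ratio (q A B : ℂ) (k : ℕ) (y : ℂ) : ℂ := qPoch (A / y) q k / qPoch (B / y) q k

section
variable {q : ℂ} (hq0 : q ≠ 0) (hq : ‖q‖ < 1)
include hq0 hq

/-- The grid may start at `x` although the endpoint is `x q^k`: the first `k` terms contain a
numerator `(q^{-j};q)_∞` with `j ≥ 0` and vanish. -/
lemma hasSum_aaWeight_lower {a b c d x : ℂ} {k : ℕ} (hx : x ≠ 0) (h : a = x * q ^ k ∨ b = x * q ^ k) :
    HasSum (fun n : ℕ => aaWeight q a b c d (x * q ^ n) * q ^ n)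
      (q ^ k * aaHalf q a b c d (x * q ^ k)) := by
  have h1 := ((hasSum_aaWeight hq (a := a) (b := b) (c := c) (d := d) (x := x * q ^ k)).mul_left
    (q ^ k))
  have h2 := (hasSum_nat_add_iff (f := fun n : ℕ => aaWeight q a b c d (x * q ^ n) * q ^ n) k
    (g := q ^ k * aaHalf q a b c d (x * q ^ k))).1 (by
      refine (funext fun n => ?_ : (fun n : ℕ => aaWeight q a b c d (x * q ^ (n + k)) * q ^ (n + k)) =
        fun n : ℕ => q ^ k * (aaWeight q a b c d (x * q ^ k * q ^ n) * q ^ n)) ▸ h1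
      rw [show x * q ^ (n + k) = x * q ^ k * q ^ n by ring]
      ring)
  rwa [Finset.sum_eq_zero, add_zero] at h2
  intro n hn
  obtain ⟨j, rfl⟩ : ∃ j, k = n + 1 + j := ⟨k - (n + 1), by have := Finset.mem_range.1 hn; omega⟩
  have h0 : qPochInf (x * q ^ n * q / (x * q ^ (n + 1 + j))) q = 0 :=
    qPochInf_eq_zero hq (k := j) (by field_simp; ring)
  rcases h with rfl | rfl <;> simp [aaWeight, h0]

/-- The moments of the factors `ratio`, reduced to Andrews–Askey integrals. -/
lemma hasBilateral_ratio_mul_ratio {μ B₁ B₂ : ℂ} (hμ : μ ≠ 0) (hB₁ : B₁ ≠ 0) (hB₂ : B₂ ≠ 0)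
    (k l : ℕ) :
    HasBilateral q μ (fun y => ratio q 1 B₁ k y * ratio q (-μ) B₂ l y *
      (qPochInf (q * y) q * qPochInf (-q * y / μ) q /
        (qPochInf (q / B₁ * y) q * qPochInf (q / B₂ * y) q)))
      ((1 / B₁) ^ k * (-μ / B₂) ^ l *
        aaIntegral q (-μ * q ^ l) (q ^ k) (q / B₁ / q ^ k) (q / B₂ / q ^ l)) := by
  have hW : ∀ y : ℂ, y ≠ 0 → ratio q 1 B₁ k y * ratio q (-μ) B₂ l y *
      (qPochInf (q * y) q * qPochInf (-q * y / μ) q /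
        (qPochInf (q / B₁ * y) q * qPochInf (q / B₂ * y) q)) = (1 / B₁) ^ k * (-μ / B₂) ^ l *
      aaWeight q (-μ * q ^ l) (q ^ k) (q / B₁ / q ^ k) (q / B₂ / q ^ l) y := by
    intro y hy
    have hsh : ∀ (A : ℂ) (k : ℕ), qPochInf (y * q / A / q ^ k) q =
        qPoch (y * q / A / q ^ k) q k * qPochInf (y * q / A) q := fun A k => by
      rw [qPochInf_eq_mul hq _ k, div_mul_cancel₀ _ (pow_ne_zero _ hq0)]
    rw [ratio, ratio, qPoch_inv_div hq0 one_ne_zero hB₁ hy, qPoch_inv_div hq0 (neg_ne_zero.2 hμ) hB₂ hy,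
      aaWeight, show y * q / (-μ * q ^ l) = y * q / -μ / q ^ l by rw [div_div],
      show y * q / q ^ k = y * q / 1 / q ^ k by rw [div_one],
      show q / B₁ / q ^ k * y = y * q / B₁ / q ^ k by ring,
      show q / B₂ / q ^ l * y = y * q / B₂ / q ^ l by ring, hsh, hsh, hsh, hsh,
      show q * y = y * q / 1 by ring, show -(q) * y / μ = y * q / -μ by rw [div_neg]; ring,
      show q / B₁ * y = y * q / B₁ by ring, show q / B₂ * y = y * q / B₂ by ring]
    simp only [div_eq_mul_inv, mul_inv]
    ring
  have h1 := hasSum_aaWeight_lower hq0 hq (a := -μ * q ^ l) (b := q ^ k) (c := q / B₁ / q ^ k)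
    (d := q / B₂ / q ^ l) (x := 1) (k := k) one_ne_zero (Or.inr (one_mul _).symm)
  have h2 := hasSum_aaWeight_lower hq0 hq (a := -μ * q ^ l) (b := q ^ k) (c := q / B₁ / q ^ k)
    (d := q / B₂ / q ^ l) (x := -μ) (k := l) (neg_ne_zero.2 hμ) (Or.inl rfl)
  simp only [one_mul] at h1
  have h3 : HasBilateral q μ
      (aaWeight q (-μ * q ^ l) (q ^ k) (q / B₁ / q ^ k) (q / B₂ / q ^ l))
      (aaIntegral q (-μ * q ^ l) (q ^ k) (q / B₁ / q ^ k) (q / B₂ / q ^ l)) :=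
    ⟨_, _, h1, h2, by rw [aaIntegral]; ring⟩
  exact (h3.const_mul ((1 / B₁) ^ k * (-μ / B₂) ^ l)).congr
    (fun n => hW _ (pow_ne_zero _ hq0))
    (fun n => hW _ (mul_ne_zero (neg_ne_zero.2 hμ) (pow_ne_zero _ hq0)))

/-- Moving `b` to `q^k` and `c` to `c/q^k` keeps `abcd`, `bc` and `ad`. Only the prefactor `b` and
the factors in `bq/a`, `a/b`, `ac`, `bd` change, and they collapse to one ratio of finite
factorials, which makes the later sum over `k` hypergeometric. -/
lemma aaIntegral_lower {a c d : ℂ} (ha0 : a ≠ 0) (hc0 : c ≠ 0) (ha : ∀ m : ℤ, a * q ^ m ≠ 1)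
    (hc : ∀ m : ℤ, c * q ^ m ≠ 1) (hd : ∀ m : ℤ, d * q ^ m ≠ 1)
    (hca : ∀ m : ℤ, c * a * q ^ m ≠ 1) (hda : ∀ m : ℤ, d * a * q ^ m ≠ 1) (k : ℕ) :
    (c / q) ^ k * aaIntegral q a (q ^ k) (c / q ^ k) d =
      qPoch d q k / qPoch (q / (a * c)) q k * aaIntegral q a 1 c d := by
  have hqk : ∀ n : ℕ, q ^ n ≠ 0 := fun n => pow_ne_zero _ hq0
  have hz : ∀ {z : ℂ} (n m : ℕ), (∀ m : ℤ, z * q ^ m ≠ 1) → z * q ^ n / q ^ m ≠ 1 := fun n m h => by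
    have := h (n - m)
    rwa [zpow_sub₀ hq0, zpow_natCast, zpow_natCast, ← mul_div_assoc] at this
  have hz' : ∀ {z : ℂ} (n m : ℕ), (∀ m : ℤ, z * q ^ m ≠ 1) → z * q ^ n ≠ q ^ m := fun n m h e =>
    hz n m h (by rw [e, div_self (hqk m)])
  rw [aaIntegral_eq hq0 hq ha0 (hqk k) (fun n => hz' (n + 1) k ha)
    (fun n h => hz' 0 (k + (n + 1)) ha (by rw [pow_add, h]; ring))
    (fun n h => hz n k hca (by rw [← h]; ring)) (fun n => by simpa using hda n)
    (fun n h => hc n (by rw [← h, div_mul_cancel₀ _ (hqk k)]; simp))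
    (fun n h => hz' (k + n) 0 hd (by rw [pow_add, ← mul_assoc, h, pow_zero])),
    aaIntegral_eq hq0 hq ha0 one_ne_zero (fun n => by simpa using hz' (n + 1) 0 ha)
    (fun n h => hz' 0 (n + 1) ha (by rw [← h]; ring))
    (fun n => by simpa using hca n) (fun n => by simpa using hda n)
    (fun n => by simpa using hc n) (fun n => by simpa using hd n)]
  have e1 := qPochInf_eq_mul hq (q / a) k
  have e2 := qPochInf_eq_mul hq (a / q ^ k) k
  have e3 := qPochInf_eq_mul hq (a * c / q ^ k) k
  have e4 := qPochInf_eq_mul hq d k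
  rw [div_mul_cancel₀ _ (hqk k)] at e2 e3
  have hlow := qPoch_lower_div hq0 (x := a) (y := a * c) ha0 (mul_ne_zero ha0 hc0) k
  have n1 : qPoch (q / a) q k ≠ 0 := qPoch_ne_zero (fun n h => hz' 0 (n + 1) ha (by
    field_simp at h; rw [pow_zero, mul_one, pow_succ', h])) k
  have n2 : qPoch (a * c / q ^ k) q k ≠ 0 := qPoch_ne_zero (fun n h => hz n k hca (by
    rw [← h]; ring)) k
  have n3 : qPoch (q / (a * c)) q k ≠ 0 := qPoch_ne_zero (fun n h => hz' 0 (n + 1) hca (by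
    field_simp at h; rw [pow_zero, mul_one, pow_succ', mul_comm c, h])) k
  have n4 : qPochInf (a * c) q ≠ 0 := qPochInf_ne_zero hq fun n => by
    simpa [mul_comm] using hca n
  have n5 : qPochInf (a * d) q ≠ 0 := qPochInf_ne_zero hq fun n => by
    simpa [mul_comm] using hda n
  have n6 : qPochInf c q ≠ 0 := qPochInf_ne_zero hq fun n => by simpa using hc n
  have n7 : qPochInf d q ≠ 0 := qPochInf_ne_zero hq fun n => by simpa using hd n
  rw [e4] at n7
  have n8 := left_ne_zero_of_mul n7
  have n9 := right_ne_zero_of_mul n7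
  have hlow' : qPoch (a / q ^ k) q k = qPoch (a * c / q ^ k) q k * ((1 / c) ^ k *
      (qPoch (q / a) q k / qPoch (q / (a * c)) q k)) := by
    rw [show (1 : ℂ) / c = a / (a * c) by field_simp, ← hlow]
    field_simp
  rw [show a * q ^ k * (c / q ^ k) * d = a * 1 * c * d by field_simp,
    show q ^ k * (c / q ^ k) = c by field_simp, show a * (c / q ^ k) = a * c / q ^ k by ring,
    show q ^ k * q / a = q / a * q ^ k by ring, show q ^ k * d = d * q ^ k by ring,
    one_mul q, div_one, one_mul c, one_mul d, e2, e3, e1, e4, hlow', div_pow, div_pow, one_pow]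
  generalize qPoch (a * c / q ^ k) q k = X1 at *
  generalize qPoch (q / a) q k = X2 at *
  generalize qPoch (q / (a * c)) q k = X3 at *
  generalize qPoch d q k = X4 at *
  generalize qPochInf (d * q ^ k) q = X5 at *
  generalize qPochInf (a * c) q = X6 at *
  generalize qPochInf (a * d) q = X7 at *
  generalize qPochInf c q = X8 at *
  generalize qPochInf (q / a * q ^ k) q = X9 at *
  generalize qPochInf a q = X10 at *
  generalize qPochInf (a * 1 * c * d) q = X11 at *
  field_simp

end

/-! ### Biorthogonality for complex parameters -/

/-- The genericity conditions on the parameters, in a form that is stable under the symmetries of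
the biorthogonal system. -/
structure Generic (q μ₁ μ₂ t₁ t₂ : ℂ) : Prop where
  q_ne : q ≠ 0
  q_lt : ‖q‖ < 1
  μ₁_ne : μ₁ ≠ 0
  μ₂_ne : μ₂ ≠ 0
  prod : t₁ * t₂ = μ₁ * μ₂
  t₁_μ₁ : ∀ m : ℤ, t₁ ≠ μ₁ * q ^ m
  t₁_μ₂ : ∀ m : ℤ, t₁ ≠ μ₂ * q ^ m
  t₁_neg : ∀ m : ℤ, t₁ ≠ -q ^ m
  t₂_neg : ∀ m : ℤ, t₂ ≠ -q ^ m
  μ₁_neg : ∀ m : ℤ, μ₁ ≠ -q ^ m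
  μ₂_neg : ∀ m : ℤ, μ₂ ≠ -q ^ m

namespace Generic

variable {q μ₁ μ₂ t₁ t₂ : ℂ}

lemma t₁_ne (G : Generic q μ₁ μ₂ t₁ t₂) : t₁ ≠ 0 := fun h =>
  mul_ne_zero G.μ₁_ne G.μ₂_ne (by rw [← G.prod, h, zero_mul])

lemma t₂_ne (G : Generic q μ₁ μ₂ t₁ t₂) : t₂ ≠ 0 := fun h =>
  mul_ne_zero G.μ₁_ne G.μ₂_ne (by rw [← G.prod, h, mul_zero])

/-- Since `t₁t₂ = μ₁μ₂`, avoiding `μ₁q^ℤ` and `μ₂q^ℤ` for `t₁` is the same as avoiding `μ₂q^ℤ` and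
`μ₁q^ℤ` for `t₂`. -/
lemma swap (G : Generic q μ₁ μ₂ t₁ t₂) : Generic q μ₁ μ₂ t₂ t₁ where
  q_ne := G.q_ne
  q_lt := G.q_lt
  μ₁_ne := G.μ₁_ne
  μ₂_ne := G.μ₂_ne
  prod := by rw [mul_comm, G.prod]
  t₁_μ₁ m h := G.t₁_μ₂ (-m) (by
    have hp := G.prod
    have h1 := G.μ₁_ne
    have h2 : q ^ m ≠ 0 := zpow_ne_zero _ G.q_ne
    rw [zpow_neg]
    field_simp
    apply mul_left_cancel₀ h1
    rw [← hp, h]; ring)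
  t₁_μ₂ m h := G.t₁_μ₁ (-m) (by
    have hp := G.prod
    have h1 := G.μ₂_ne
    have h2 : q ^ m ≠ 0 := zpow_ne_zero _ G.q_ne
    rw [zpow_neg]
    field_simp
    apply mul_left_cancel₀ h1
    rw [mul_comm μ₂ μ₁, ← hp, h]; ring)
  t₁_neg := G.t₂_neg
  t₂_neg := G.t₁_neg
  μ₁_neg := G.μ₁_neg
  μ₂_neg := G.μ₂_neg

/-- The parameter change that carries the negative branch to the positive one. The `t`'s also trade
places because `u` uses `t₁` on the positive branch and `t₂` on the negative one. -/
lemma inv (G : Generic q μ₁ μ₂ t₁ t₂) : Generic q μ₁⁻¹ μ₂⁻¹ t₂⁻¹ t₁⁻¹ where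
  q_ne := G.q_ne
  q_lt := G.q_lt
  μ₁_ne := inv_ne_zero G.μ₁_ne
  μ₂_ne := inv_ne_zero G.μ₂_ne
  prod := by rw [← mul_inv, ← mul_inv, mul_comm, G.prod]
  t₁_μ₁ m h := G.swap.t₁_μ₁ (-m) (by rw [zpow_neg, ← inv_inj, h, mul_inv, inv_inv])
  t₁_μ₂ m h := G.swap.t₁_μ₂ (-m) (by rw [zpow_neg, ← inv_inj, h, mul_inv, inv_inv])
  t₁_neg m h := G.t₂_neg (-m) (by rw [zpow_neg, ← inv_inj, h, inv_neg, inv_inv])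
  t₂_neg m h := G.t₁_neg (-m) (by rw [zpow_neg, ← inv_inj, h, inv_neg, inv_inv])
  μ₁_neg m h := G.μ₁_neg (-m) (by rw [zpow_neg, ← inv_inj, h, inv_neg, inv_inv])
  μ₂_neg m h := G.μ₂_neg (-m) (by rw [zpow_neg, ← inv_inj, h, inv_neg, inv_inv])

end Generic

/-- The rational function on the positive branch, with complex parameters. -/
def rPos (q μ₁ μ₂ t x y : ℂ) : ℂ :=
  phi32 x⁻¹ y⁻¹ (-q / t) (q * μ₁ / (t * x)) (q * μ₂ / (t * y)) q q

/-- The rational function on the negative branch, with complex parameters. -/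
def rNeg (q μ₁ μ₂ t x y : ℂ) : ℂ :=
  phi32 (-μ₁ / x) (-μ₂ / y) (-q * t) (-q * t / x) (-q * t / y) q q

lemma rNeg_eq_rPos {q μ₁ μ₂ t : ℂ} (hμ₁ : μ₁ ≠ 0) (hμ₂ : μ₂ ≠ 0) (x y : ℂ) :
    rNeg q μ₁ μ₂ t (-μ₁ * x) (-μ₂ * y) = rPos q μ₁⁻¹ μ₂⁻¹ t⁻¹ x y := by
  rw [rNeg, rPos, show -μ₁ / (-μ₁ * x) = x⁻¹ by field_simp, show -μ₂ / (-μ₂ * y) = y⁻¹ by field_simp,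
    show -q / t⁻¹ = -q * t by rw [div_inv_eq_mul],
    show q * μ₁⁻¹ / (t⁻¹ * x) = -q * t / (-μ₁ * x) by simp only [div_eq_mul_inv, mul_inv, inv_inv, inv_neg]; ring,
    show q * μ₂⁻¹ / (t⁻¹ * y) = -q * t / (-μ₂ * y) by simp only [div_eq_mul_inv, mul_inv, inv_inv, inv_neg]; ring]

/-- The coefficients of `rPos` at `x = q^s`. -/
def coeff (q μ₁ t : ℂ) (s k : ℕ) : ℂ :=
  qPoch (q ^ s)⁻¹ q k * qPoch (-q / t) q k / (qPoch (q * μ₁ / t / q ^ s) q k * qPoch q q k) * q ^ k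

lemma qPoch_inv_pow_eq_zero {q : ℂ} (hq : q ≠ 0) {s k : ℕ} (h : s < k) :
    qPoch (q ^ s)⁻¹ q k = 0 :=
  qPoch_eq_zero (inv_mul_cancel₀ (pow_ne_zero _ hq)) h

lemma rPos_pow {q : ℂ} (hq : q ≠ 0) (μ₁ μ₂ t : ℂ) (s : ℕ) (y : ℂ) :
    rPos q μ₁ μ₂ t (q ^ s) y =
      ∑ k ∈ Finset.range (s + 1), coeff q μ₁ t s k * ratio q 1 (q * μ₂ / t) k y := by
  rw [rPos, phi32, tsum_eq_sum (s := Finset.range (s + 1))]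
  · refine Finset.sum_congr rfl fun k _ => ?_
    rw [coeff, ratio, one_div, div_div, div_div]
    simp only [div_eq_mul_inv, mul_inv]
    ring
  · intro k hk
    rw [qPoch_inv_pow_eq_zero hq (by simpa [Nat.lt_succ_iff] using hk)]
    simp

/-- The rational function on the negative branch is a sum of the second family of ratios. -/
lemma rNeg_pow {q : ℂ} (hq : q ≠ 0) {μ₁ : ℂ} (hμ₁ : μ₁ ≠ 0) (μ₂ t : ℂ) (s : ℕ) (y : ℂ) :
    rNeg q μ₁ μ₂ t (-μ₁ * q ^ s) y =
      ∑ k ∈ Finset.range (s + 1), coeff q μ₁⁻¹ t⁻¹ s k * ratio q (-μ₂) (-q * t) k y := by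
  rw [rNeg, phi32, tsum_eq_sum (s := Finset.range (s + 1))]
  · refine Finset.sum_congr rfl fun k _ => ?_
    rw [coeff, ratio, show -μ₁ / (-μ₁ * q ^ s) = (q ^ s)⁻¹ by field_simp,
      show -q / t⁻¹ = -q * t by rw [div_inv_eq_mul],
      show q * μ₁⁻¹ / t⁻¹ / q ^ s = -q * t / (-μ₁ * q ^ s) by
        simp only [div_eq_mul_inv, mul_inv, inv_inv, inv_neg]; ring]
    simp only [div_eq_mul_inv, mul_inv]
    ring
  · intro k hk
    rw [show -μ₁ / (-μ₁ * q ^ s) = (q ^ s)⁻¹ by field_simp,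
      qPoch_inv_pow_eq_zero hq (by simpa [Nat.lt_succ_iff] using hk)]
    simp

/-! ### Orthogonality across branches, and moments on the positive branch. -/

section
variable {q μ₁ μ₂ t₁ t₂ : ℂ}

/-- Functions on different branches are orthogonal. -/
theorem hasBilateral_pos_neg (G : Generic q μ₁ μ₂ t₁ t₂) (s s' : ℕ) :
    HasBilateral q μ₂ (fun y => rPos q μ₁ μ₂ t₁ (q ^ s) y * rNeg q μ₁ μ₂ t₁ (-μ₁ * q ^ s') y *
      (qPochInf (q * y) q * qPochInf (-q * y / μ₂) q /
        (qPochInf (t₁ * y / μ₂) q * qPochInf (-y / t₁) q))) 0 := by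
  have hq := G.q_ne
  have h1 := G.t₁_ne
  have hμ₂ := G.μ₂_ne
  have hM : ∀ k l : ℕ, HasBilateral q μ₂ (fun y => ratio q 1 (q * μ₂ / t₁) k y *
      ratio q (-μ₂) (-q * t₁) l y * (qPochInf (q * y) q * qPochInf (-q * y / μ₂) q /
        (qPochInf (t₁ * y / μ₂) q * qPochInf (-y / t₁) q))) 0 := by
    intro k l
    have h := hasBilateral_ratio_mul_ratio hq G.q_lt hμ₂ (B₁ := q * μ₂ / t₁) (B₂ := -q * t₁)
      (by positivity) (mul_ne_zero (neg_ne_zero.2 hq) h1) k l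
    have hpow : ∀ n : ℕ, q ^ n ≠ 0 := fun n => pow_ne_zero _ hq
    rw [show q / (q * μ₂ / t₁) = t₁ / μ₂ by field_simp, show q / (-q * t₁) = -1 / t₁ by field_simp,
      aaIntegral_eq hq G.q_lt (mul_ne_zero (neg_ne_zero.2 hμ₂) (hpow l)) (hpow k)
      (fun n e => G.μ₂_neg (k - l - (n + 1)) (by
        rw [zpow_sub₀ hq, zpow_sub₀ hq]; norm_cast
        rw [← e]
        have := hpow l; have := hpow (n + 1)
        field_simp))
      (fun n e => G.μ₂_neg (k + (n + 1) - l) (by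
        rw [zpow_sub₀ hq, zpow_add₀ hq]; norm_cast
        rw [e]
        have := hpow l
        field_simp))
      (fun n e => G.t₁_neg (k - l - n) (by
        rw [zpow_sub₀ hq, zpow_sub₀ hq]; norm_cast
        have := hpow l; have := hpow n; have := hpow k
        field_simp at e ⊢
        linear_combination -e))
      (fun n e => G.t₁_μ₂ n (by
        have := hpow l
        field_simp at e
        rw [zpow_natCast, ← e]))
      (fun n e => G.t₁_μ₂ (-n) (by
        have := hpow k; have := hpow n
        rw [zpow_neg, zpow_natCast]
        field_simp at e ⊢
        exact e))
      (fun n e => G.t₁_neg (k + n - l) (by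
        have := hpow l
        rw [zpow_sub₀ hq, zpow_add₀ hq]; norm_cast
        field_simp at e ⊢
        linear_combination -e)),
      -- Here `abcd = 1`, so the numerator `(abcd;q)_∞` kills every moment.
      show -μ₂ * q ^ l * q ^ k * (t₁ / μ₂ / q ^ k) * (-1 / t₁ / q ^ l) = 1 by
        have := hpow l; have := hpow k
        field_simp,
      qPochInf_eq_zero G.q_lt (a := 1) (k := 0) (by simp)] at h
    simp only [mul_zero, zero_div] at h
    refine h.congr (fun n => ?_) (fun n => ?_) <;> congr 4 <;> ring
  have hsum := HasBilateral.sum (s := Finset.range (s + 1)) fun k _ =>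
    HasBilateral.sum (s := Finset.range (s' + 1)) fun l _ =>
      (hM k l).const_mul (coeff q μ₁ t₁ s k * coeff q μ₁⁻¹ t₁⁻¹ s' l)
  simp only [mul_zero, Finset.sum_const_zero] at hsum
  have hE : ∀ y : ℂ, rPos q μ₁ μ₂ t₁ (q ^ s) y * rNeg q μ₁ μ₂ t₁ (-μ₁ * q ^ s') y *
      (qPochInf (q * y) q * qPochInf (-q * y / μ₂) q /
        (qPochInf (t₁ * y / μ₂) q * qPochInf (-y / t₁) q)) =
      ∑ k ∈ Finset.range (s + 1), ∑ l ∈ Finset.range (s' + 1),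
        coeff q μ₁ t₁ s k * coeff q μ₁⁻¹ t₁⁻¹ s' l * (ratio q 1 (q * μ₂ / t₁) k y *
      ratio q (-μ₂) (-q * t₁) l y * (qPochInf (q * y) q * qPochInf (-q * y / μ₂) q /
        (qPochInf (t₁ * y / μ₂) q * qPochInf (-y / t₁) q))) := by
    intro y
    rw [rPos_pow hq, rNeg_pow hq G.μ₁_ne, Finset.sum_mul_sum, Finset.sum_mul]
    refine Finset.sum_congr rfl fun k _ => ?_
    rw [Finset.sum_mul]
    exact Finset.sum_congr rfl fun l _ => by ring
  exact hsum.congr (fun n => hE _) (fun n => hE _)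

/-- The weight on the positive branch. -/
def wPos (q μ₂ t₁ t₂ y : ℂ) : ℂ :=
  qPochInf (q * y) q * qPochInf (-q * y / μ₂) q /
    (qPochInf (t₁ * y / μ₂) q * qPochInf (t₂ * y / μ₂) q)

/-- The integral of `rPos` against the second family of ratios. -/
lemma hasBilateral_rPos_mul_ratio (G : Generic q μ₁ μ₂ t₁ t₂) (s l : ℕ) :
    HasBilateral q μ₂ (fun y => rPos q μ₁ μ₂ t₁ (q ^ s) y * ratio q (-μ₂) (q * μ₂ / t₂) l y *
      wPos q μ₂ t₁ t₂ y)
      ((-t₂ / q) ^ l * aaIntegral q (-μ₂ * q ^ l) 1 (t₁ / μ₂) (t₂ / μ₂ / q ^ l) *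
        (qPoch (q ^ l)⁻¹ q s * qPoch (-q / μ₁) q s /
          (qPoch (-q / (t₁ * q ^ l)) q s * qPoch (t₁ / μ₁) q s))) := by
  have hq := G.q_ne
  have h1 := G.t₁_ne
  have h2 := G.t₂_ne
  have hμ₁ := G.μ₁_ne
  have hμ₂ := G.μ₂_ne
  have hpow : ∀ n : ℕ, q ^ n ≠ 0 := fun n => pow_ne_zero _ hq
  have hzp : ∀ m : ℤ, q ^ m ≠ 0 := fun m => zpow_ne_zero _ hq
  have hM : ∀ k : ℕ, HasBilateral q μ₂ (fun y => ratio q 1 (q * μ₂ / t₁) k y *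
      ratio q (-μ₂) (q * μ₂ / t₂) l y * wPos q μ₂ t₁ t₂ y)
      ((-t₂ / q) ^ l * aaIntegral q (-μ₂ * q ^ l) 1 (t₁ / μ₂) (t₂ / μ₂ / q ^ l) *
        (qPoch (t₂ / μ₂ / q ^ l) q k / qPoch (-q / (t₁ * q ^ l)) q k)) := by
    intro k
    have h := hasBilateral_ratio_mul_ratio hq G.q_lt hμ₂ (B₁ := q * μ₂ / t₁) (B₂ := q * μ₂ / t₂)
      (by positivity) (by positivity) k l
    have hlow := aaIntegral_lower hq G.q_lt (a := -μ₂ * q ^ l) (c := t₁ / μ₂) (d := t₂ / μ₂ / q ^ l)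
      (mul_ne_zero (neg_ne_zero.2 hμ₂) (hpow l)) (by positivity)
      (fun m e => G.μ₂_neg (-(l + m)) (by
        have := hpow l; have := hzp m
        rw [zpow_neg, zpow_add₀ hq, zpow_natCast]
        field_simp
        linear_combination -e))
      (fun m e => G.t₁_μ₂ (-m) (by
        have := hzp m
        rw [zpow_neg]
        field_simp at e ⊢
        exact e))
      (fun m e => G.swap.t₁_μ₂ (l - m) (by
        have := hpow l; have := hzp m
        rw [zpow_sub₀ hq, zpow_natCast]
        field_simp at e ⊢
        exact e))
      (fun m e => G.t₁_neg (-(l + m)) (by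
        have := hpow l; have := hzp m
        rw [zpow_neg, zpow_add₀ hq, zpow_natCast]
        field_simp at e ⊢
        linear_combination -e))
      (fun m e => G.t₂_neg (-m) (by
        have := hpow l; have := hzp m
        rw [zpow_neg]
        field_simp at e ⊢
        linear_combination -e)) k
    rw [show q / (q * μ₂ / t₁) = t₁ / μ₂ by field_simp, show q / (q * μ₂ / t₂) = t₂ / μ₂ by field_simp,
      show 1 / (q * μ₂ / t₁) = t₁ / μ₂ / q by field_simp, show -μ₂ / (q * μ₂ / t₂) = -t₂ / q by field_simp,
      mul_right_comm, hlow, show q / (-μ₂ * q ^ l * (t₁ / μ₂)) = -q / (t₁ * q ^ l) by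
        have := hpow l
        field_simp] at h
    rw [show (-t₂ / q) ^ l * aaIntegral q (-μ₂ * q ^ l) 1 (t₁ / μ₂) (t₂ / μ₂ / q ^ l) *
        (qPoch (t₂ / μ₂ / q ^ l) q k / qPoch (-q / (t₁ * q ^ l)) q k) =
        qPoch (t₂ / μ₂ / q ^ l) q k / qPoch (-q / (t₁ * q ^ l)) q k *
        aaIntegral q (-μ₂ * q ^ l) 1 (t₁ / μ₂) (t₂ / μ₂ / q ^ l) * (-t₂ / q) ^ l by ring]
    refine h.congr (fun n => ?_) (fun n => ?_) <;> rw [wPos] <;> congr 4 <;> ring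
  have hsum := HasBilateral.sum (s := Finset.range (s + 1)) fun k _ =>
    (hM k).const_mul (coeff q μ₁ t₁ s k)
  -- The lower parameter `d` comes from `coeff`; the balancing condition reduces to `t₁t₂ = μ₁μ₂`.
  -- Since `c/a = q^{-l}`, the sum contains `(q^{-l};q)_s`.
  have hS := qSaalschutz (a := -q / t₁) (b := t₂ / μ₂ / q ^ l) (c := -q / (t₁ * q ^ l))
    (d := q * μ₁ / t₁ / q ^ s) (n := s) hq (qPoch_self_ne_zero G.q_lt)
    (qPoch_ne_zero fun k e => G.t₁_neg (k + 1 - l) (by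
      have := hpow l
      rw [zpow_sub₀ hq]; norm_cast
      field_simp at e ⊢
      linear_combination -e))
    (div_ne_zero (neg_ne_zero.2 hq) h1) (div_ne_zero (div_ne_zero h2 hμ₂) (hpow l))
    (div_ne_zero (neg_ne_zero.2 hq) (mul_ne_zero h1 (hpow l)))
    (by
      have := hpow l; have := hpow s
      field_simp
      exact G.prod.symm ▸ by ring)
    (qPoch_ne_zero (fun k e => G.swap.t₁_μ₂ k (by
      have := hpow l
      field_simp at e
      rw [zpow_natCast, ← e])) s)
  have e1 : -q / (t₁ * q ^ l) / (-q / t₁) = (q ^ l)⁻¹ := by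
    have := hpow l; field_simp
  have e2 : -q / (t₁ * q ^ l) / (t₂ / μ₂ / q ^ l) = -q / μ₁ := by
    have := hpow l; have hp := G.prod
    field_simp
    linear_combination hp
  have e3 : -q / (t₁ * q ^ l) / (-q / t₁ * (t₂ / μ₂ / q ^ l)) = t₁ / μ₁ := by
    have := hpow l; have hp := G.prod
    field_simp
    linear_combination -hp
  rw [e1, e2, e3] at hS
  have hv : ∑ k ∈ Finset.range (s + 1), coeff q μ₁ t₁ s k *
      ((-t₂ / q) ^ l * aaIntegral q (-μ₂ * q ^ l) 1 (t₁ / μ₂) (t₂ / μ₂ / q ^ l) *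
        (qPoch (t₂ / μ₂ / q ^ l) q k / qPoch (-q / (t₁ * q ^ l)) q k)) =
      (-t₂ / q) ^ l * aaIntegral q (-μ₂ * q ^ l) 1 (t₁ / μ₂) (t₂ / μ₂ / q ^ l) *
        (qPoch (q ^ l)⁻¹ q s * qPoch (-q / μ₁) q s /
          (qPoch (-q / (t₁ * q ^ l)) q s * qPoch (t₁ / μ₁) q s)) := by
    rw [← hS, Finset.mul_sum]
    refine Finset.sum_congr rfl fun k _ => ?_
    rw [coeff]
    simp only [div_eq_mul_inv, mul_inv]
    ring
  rw [hv] at hsum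
  have hE : ∀ y : ℂ, rPos q μ₁ μ₂ t₁ (q ^ s) y * ratio q (-μ₂) (q * μ₂ / t₂) l y *
      wPos q μ₂ t₁ t₂ y = ∑ k ∈ Finset.range (s + 1), coeff q μ₁ t₁ s k *
      (ratio q 1 (q * μ₂ / t₁) k y * ratio q (-μ₂) (q * μ₂ / t₂) l y * wPos q μ₂ t₁ t₂ y) := by
    intro y
    rw [rPos_pow hq, Finset.sum_mul, Finset.sum_mul]
    exact Finset.sum_congr rfl fun k _ => by ring
  exact hsum.congr (fun n => hE _) (fun n => hE _)

end

/-! ### Connection coefficients and the squared norm. -/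

section
variable {q μ₁ μ₂ t₁ t₂ : ℂ}

/-- The connection coefficients between the two families of ratios. -/
def connCoeff (q μ₂ t₂ : ℂ) (k l : ℕ) : ℂ :=
  qPoch (-1 / μ₂) q k / qPoch (-q / t₂) q k *
    (qPoch (q ^ k)⁻¹ q l * qPoch (q * μ₂ / t₂) q l /
      (qPoch (-μ₂ * q / q ^ k) q l * qPoch q q l) * q ^ l)

/-- Saalschütz read backwards: `c/b = 1/y` and `c = qμ₂/(t₂y)` make the closed form the factor at
`1`, while the summands carry the factors at `-μ₂`. -/
lemma ratio_one_eq_sum (G : Generic q μ₁ μ₂ t₁ t₂) (k : ℕ) {y : ℂ} (hy : y ≠ 0)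
    (hB : ∀ n : ℕ, q * μ₂ / t₂ / y * q ^ n ≠ 1) :
    ratio q 1 (q * μ₂ / t₂) k y = ∑ l ∈ Finset.range (k + 1),
      connCoeff q μ₂ t₂ k l * ratio q (-μ₂) (q * μ₂ / t₂) l y := by
  have hq := G.q_ne
  have h2 := G.t₂_ne
  have hμ₂ := G.μ₂_ne
  have hpow : ∀ n : ℕ, q ^ n ≠ 0 := fun n => pow_ne_zero _ hq
  have e3 : q * μ₂ / t₂ / y / (-μ₂ / y * (q * μ₂ / t₂)) = -1 / μ₂ := by field_simp
  have n1 : qPoch (-1 / μ₂) q k ≠ 0 := qPoch_ne_zero (fun n e => G.μ₂_neg n (by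
    field_simp at e
    rw [zpow_natCast, ← e])) k
  have n2 : qPoch (-q / t₂) q k ≠ 0 := qPoch_ne_zero (fun n e => G.t₂_neg (n + 1) (by
    field_simp at e
    norm_cast
    rw [← e, pow_succ]; ring)) k
  have hS := qSaalschutz (a := -μ₂ / y) (b := q * μ₂ / t₂) (c := q * μ₂ / t₂ / y)
    (d := -μ₂ * q / q ^ k) (n := k) hq (qPoch_self_ne_zero G.q_lt) (qPoch_ne_zero hB)
    (div_ne_zero (neg_ne_zero.2 hμ₂) hy) (by positivity) (by positivity)
    (by have := hpow k; field_simp) (by rwa [e3])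
  rw [e3, show q * μ₂ / t₂ / y / (-μ₂ / y) = -q / t₂ by field_simp,
    show q * μ₂ / t₂ / y / (q * μ₂ / t₂) = 1 / y by field_simp] at hS
  have hR : ratio q 1 (q * μ₂ / t₂) k y = qPoch (-1 / μ₂) q k / qPoch (-q / t₂) q k *
      (qPoch (-q / t₂) q k * qPoch (1 / y) q k /
        (qPoch (q * μ₂ / t₂ / y) q k * qPoch (-1 / μ₂) q k)) := by
    rw [ratio]
    generalize qPoch (-1 / μ₂) q k = X1 at *
    generalize qPoch (-q / t₂) q k = X2 at *
    generalize qPoch (q * μ₂ / t₂ / y) q k = X3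
    generalize qPoch (1 / y) q k = X4
    field_simp
  rw [hR, ← hS, Finset.mul_sum]
  refine Finset.sum_congr rfl fun l _ => ?_
  rw [connCoeff, ratio]
  simp only [div_eq_mul_inv, mul_inv]
  ring

/-- The squared norm on the positive branch, with complex parameters. -/
def normPos (q μ₁ μ₂ t₁ t₂ x : ℂ) : ℂ :=
  qPochInf q q * qPochInf q q * qPochInf (-μ₁) q * qPochInf (-μ₂) q *
      qPochInf (-q / μ₁) q * qPochInf (-q / μ₂) q /
    (qPochInf (-t₁) q * qPochInf (-t₂) q * qPochInf (t₁ / μ₁) q * qPochInf (t₂ / μ₁) q *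
      qPochInf (t₁ / μ₂) q * qPochInf (t₂ / μ₂) q) *
  (qPochInf (t₁ * x / μ₁) q * qPochInf (t₂ * x / μ₁) q /
    (qPochInf (q * x) q * qPochInf (-q * x / μ₁) q)) * x⁻¹

lemma normPos_swap (q μ₁ μ₂ t₁ t₂ x : ℂ) : normPos q μ₁ μ₂ t₁ t₂ x = normPos q μ₁ μ₂ t₂ t₁ x := by
  unfold normPos
  congr 2
  · congr 1
    ring
  · rw [mul_comm (qPochInf (t₁ * x / μ₁) q)]

/-- The left side is the one term `k = l = s` that survives in the diagonal double sum. -/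
lemma normPos_eq (G : Generic q μ₁ μ₂ t₁ t₂) (s : ℕ) :
    coeff q μ₁ t₂ s s * connCoeff q μ₂ t₂ s s *
      ((-t₂ / q) ^ s * aaIntegral q (-μ₂ * q ^ s) 1 (t₁ / μ₂) (t₂ / μ₂ / q ^ s) *
        (qPoch (q ^ s)⁻¹ q s * qPoch (-q / μ₁) q s /
          (qPoch (-q / (t₁ * q ^ s)) q s * qPoch (t₁ / μ₁) q s))) =
      normPos q μ₁ μ₂ t₁ t₂ (q ^ s) := by
  have hq := G.q_ne
  have h1 := G.t₁_ne
  have h2 := G.t₂_ne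
  have hμ₁ := G.μ₁_ne
  have hμ₂ := G.μ₂_ne
  have hpow : ∀ n : ℕ, q ^ n ≠ 0 := fun n => pow_ne_zero _ hq
  have hs := hpow s
  rw [aaIntegral_eq hq G.q_lt (mul_ne_zero (neg_ne_zero.2 hμ₂) hs) one_ne_zero
    (fun n e => G.μ₂_neg (-(s + (n + 1))) (by
      have := hpow (n + 1)
      rw [zpow_neg, zpow_add₀ hq]; norm_cast
      field_simp
      linear_combination -e))
    (fun n e => G.μ₂_neg (n + 1 - s) (by
      rw [zpow_sub₀ hq]; norm_cast
      rw [one_mul] at e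
      rw [e]
      field_simp))
    (fun n e => G.t₁_neg (-(s + n)) (by
      have := hpow n
      rw [zpow_neg, zpow_add₀ hq]; norm_cast
      field_simp at e ⊢
      linear_combination -e))
    (fun n e => G.t₂_neg (-n) (by
      have := hpow n
      rw [zpow_neg]; norm_cast
      field_simp at e ⊢
      linear_combination -e))
    (fun n e => G.t₁_μ₂ (-n) (by
      have := hpow n
      rw [zpow_neg]; norm_cast
      field_simp at e ⊢
      exact e))
    (fun n e => G.swap.t₁_μ₂ (s - n) (by
      have := hpow n
      rw [zpow_sub₀ hq]; norm_cast
      field_simp at e ⊢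
      exact e))]
  have f1 := qPochInf_eq_mul G.q_lt q s
  have f2 := qPochInf_eq_mul G.q_lt (-q / μ₁) s
  have f3 := qPochInf_eq_mul G.q_lt (t₁ / μ₁) s
  have f4 := qPochInf_eq_mul G.q_lt (t₂ / μ₁) s
  have f5 := qPochInf_eq_mul G.q_lt (-μ₂) s
  have f6 := qPochInf_eq_mul G.q_lt (-q / μ₂ / q ^ s) s
  have f7 := qPochInf_eq_mul G.q_lt (-t₁) s
  have f8 := qPochInf_eq_mul G.q_lt (t₂ / μ₂ / q ^ s) s
  rw [div_mul_cancel₀ _ hs] at f6 f8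
  have r1 := qPoch_lower_div hq (x := 1) (y := q * μ₁ / t₂) one_ne_zero (by positivity) s
  have r2 := qPoch_lower_div hq (x := 1) (y := -q / t₁) one_ne_zero
    (div_ne_zero (neg_ne_zero.2 hq) h1) s
  have r3 := qPoch_lower_div hq (x := 1) (y := t₂ / μ₂) one_ne_zero (by positivity) s
  have r4 := qPoch_lower_div hq (x := -q / μ₂) (y := -μ₂ * q)
    (div_ne_zero (neg_ne_zero.2 hq) hμ₂) (mul_ne_zero (neg_ne_zero.2 hμ₂) hq) s
  rw [one_div (q ^ s), div_one, show q / (q * μ₁ / t₂) = t₂ / μ₁ by field_simp,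
    show 1 / (q * μ₁ / t₂) = t₂ / (q * μ₁) by field_simp] at r1
  rw [one_div (q ^ s), div_one, show q / (-q / t₁) = -t₁ by field_simp,
    show 1 / (-q / t₁) = -t₁ / q by field_simp, div_div] at r2
  rw [one_div (q ^ s), div_one, show q / (t₂ / μ₂) = q * μ₂ / t₂ by field_simp,
    show 1 / (t₂ / μ₂) = μ₂ / t₂ by field_simp] at r3
  rw [show q / (-q / μ₂) = -μ₂ by field_simp, show q / (-μ₂ * q) = -1 / μ₂ by field_simp,
    show -q / μ₂ / (-μ₂ * q) = 1 / (μ₂ * μ₂) by field_simp] at r4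
  -- nonvanishing of the factors that cancel
  have p1 : qPoch (-1 / μ₂) q s ≠ 0 := qPoch_ne_zero (fun n e => G.μ₂_neg n (by
    field_simp at e
    rw [zpow_natCast, ← e])) s
  have p2 : qPoch (-q / t₂) q s ≠ 0 := qPoch_ne_zero (fun n e => G.t₂_neg (n + 1) (by
    field_simp at e
    norm_cast
    rw [← e, pow_succ]; ring)) s
  have p3 : qPoch (q * μ₂ / t₂) q s ≠ 0 := qPoch_ne_zero (fun n e => G.swap.t₁_μ₂ (n + 1) (by
    field_simp at e
    norm_cast
    rw [← e, pow_succ]; ring)) s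
  have p4 := qPoch_self_ne_zero G.q_lt s
  have g1 := qPochInf_self_ne_zero G.q_lt
  have g2 : qPochInf (-q / μ₁) q ≠ 0 := qPochInf_ne_zero G.q_lt fun n e => G.μ₁_neg (n + 1) (by
    field_simp at e
    norm_cast
    linear_combination -e)
  have g3 : qPochInf (t₁ / μ₁) q ≠ 0 := qPochInf_ne_zero G.q_lt fun n e => G.t₁_μ₁ (-n) (by
    have := hpow n
    rw [zpow_neg]; norm_cast
    field_simp at e ⊢
    exact e)
  have g4 : qPochInf (t₂ / μ₁) q ≠ 0 := qPochInf_ne_zero G.q_lt fun n e => G.swap.t₁_μ₁ (-n) (by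
    have := hpow n
    rw [zpow_neg]; norm_cast
    field_simp at e ⊢
    exact e)
  have g5 : qPochInf (-μ₂) q ≠ 0 := qPochInf_ne_zero G.q_lt fun n e => G.μ₂_neg (-n) (by
    have := hpow n
    rw [zpow_neg]; norm_cast
    field_simp
    linear_combination -e)
  have g7 : qPochInf (-t₁) q ≠ 0 := qPochInf_ne_zero G.q_lt fun n e => G.t₁_neg (-n) (by
    have := hpow n
    rw [zpow_neg]; norm_cast
    field_simp
    linear_combination -e)
  have g8 : qPochInf (t₂ / μ₂ / q ^ s) q ≠ 0 := qPochInf_ne_zero G.q_lt fun n e =>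
    G.swap.t₁_μ₂ (s - n) (by
      have := hpow n
      rw [zpow_sub₀ hq]; norm_cast
      field_simp at e ⊢
      exact e)
  have g9 : qPochInf (-t₂) q ≠ 0 := qPochInf_ne_zero G.q_lt fun n e => G.t₂_neg (-n) (by
    have := hpow n
    rw [zpow_neg]; norm_cast
    field_simp
    linear_combination -e)
  have g10 : qPochInf (t₁ / μ₂) q ≠ 0 := qPochInf_ne_zero G.q_lt fun n e => G.t₁_μ₂ (-n) (by
    have := hpow n
    rw [zpow_neg]; norm_cast
    field_simp at e ⊢
    exact e)
  rw [coeff, connCoeff, normPos,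
    show (1 : ℂ) * q / (-μ₂ * q ^ s) = -q / μ₂ / q ^ s by field_simp, div_one,
    show -μ₂ * q ^ s * 1 * (t₁ / μ₂) * (t₂ / μ₂ / q ^ s) = -μ₁ by
      field_simp
      linear_combination -G.prod,
    show -μ₂ * q ^ s * (t₁ / μ₂) = -t₁ * q ^ s by field_simp,
    show -μ₂ * q ^ s * (t₂ / μ₂ / q ^ s) = -t₂ by field_simp,
    show t₁ * q ^ s / μ₁ = t₁ / μ₁ * q ^ s by ring, show t₂ * q ^ s / μ₁ = t₂ / μ₁ * q ^ s by ring,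
    show -q * q ^ s / μ₁ = -q / μ₁ * q ^ s by ring, one_mul, one_mul, one_mul, f6]
  -- All powers produced by the reversals and by the moment collapse, through `t₁t₂ = μ₁μ₂`, to the
  -- factor `x⁻¹` of the norm.
  have hP : ((t₂ / (q * μ₁)) * (-t₁ / q) * (μ₂ / t₂) * (1 / (μ₂ * μ₂)) * (-t₂ / q)) ^ s *
      (q ^ s * q ^ s) = (q ^ s)⁻¹ := by
    rw [← mul_pow, ← mul_pow, ← inv_pow]
    congr 1
    field_simp
    linear_combination G.prod
  rw [mul_pow, mul_pow, mul_pow, mul_pow] at hP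
  rw [f1] at g1
  rw [f2] at g2
  rw [f3] at g3
  rw [f4] at g4
  rw [f5] at g5
  rw [f7] at g7
  rw [f8] at g8
  rw [f1, f2, f3, f4, f5, f7, f8]
  have hL : qPoch (q ^ s)⁻¹ q s / qPoch (q * μ₁ / t₂ / q ^ s) q s *
      (qPoch (q ^ s)⁻¹ q s / qPoch (-q / (t₁ * q ^ s)) q s) *
      (qPoch (q ^ s)⁻¹ q s / qPoch (t₂ / μ₂ / q ^ s) q s) *
      (qPoch (-q / μ₂ / q ^ s) q s / qPoch (-μ₂ * q / q ^ s) q s) *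
      ((-t₂ / q) ^ s * (q ^ s * q ^ s)) =
      (q ^ s)⁻¹ * (qPoch q q s / qPoch (t₂ / μ₁) q s * (qPoch q q s / qPoch (-t₁) q s) *
        (qPoch q q s / qPoch (q * μ₂ / t₂) q s) * (qPoch (-μ₂) q s / qPoch (-1 / μ₂) q s)) := by
    rw [r1, r2, r3, r4, ← hP]
    ring
  clear r1 r2 r3 r4 f1 f2 f3 f4 f5 f6 f7 f8 hP
  obtain ⟨g1a, g1b⟩ := mul_ne_zero_iff.1 g1
  obtain ⟨g2a, g2b⟩ := mul_ne_zero_iff.1 g2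
  obtain ⟨g3a, g3b⟩ := mul_ne_zero_iff.1 g3
  obtain ⟨g4a, g4b⟩ := mul_ne_zero_iff.1 g4
  obtain ⟨g5a, g5b⟩ := mul_ne_zero_iff.1 g5
  obtain ⟨g7a, g7b⟩ := mul_ne_zero_iff.1 g7
  obtain ⟨g8a, g8b⟩ := mul_ne_zero_iff.1 g8
  trans (qPoch (q ^ s)⁻¹ q s / qPoch (q * μ₁ / t₂ / q ^ s) q s *
      (qPoch (q ^ s)⁻¹ q s / qPoch (-q / (t₁ * q ^ s)) q s) *
      (qPoch (q ^ s)⁻¹ q s / qPoch (t₂ / μ₂ / q ^ s) q s) *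
      (qPoch (-q / μ₂ / q ^ s) q s / qPoch (-μ₂ * q / q ^ s) q s) *
      ((-t₂ / q) ^ s * (q ^ s * q ^ s))) *
      (qPoch (-1 / μ₂) q s * qPoch (q * μ₂ / t₂) q s * qPoch (-q / μ₁) q s /
        (qPoch q q s * qPoch q q s * qPoch (t₁ / μ₁) q s) *
      (qPoch q q s * qPochInf (q * q ^ s) q * qPochInf (-q / μ₂) q *
        qPochInf (-μ₂ * q ^ s) q * qPochInf (-μ₁) q /
        (qPochInf (-t₁ * q ^ s) q * qPochInf (-t₂) q * qPochInf (t₁ / μ₂) q *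
          qPochInf (t₂ / μ₂) q)))
  · clear hL
    -- `coeff` contributes `(-q/t₂;q)_s` and `connCoeff` its inverse; padding the right side with
    -- the same pair lets `ring` match them without cancelling.
    have hone : ∀ L R : ℂ, L = R * (qPoch (-q / t₂) q s * (qPoch (-q / t₂) q s)⁻¹) → L = R :=
      fun L R h => by rw [h, mul_inv_cancel₀ p2, mul_one]
    apply hone
    generalize qPoch (-q / t₂) q s = Z
    simp only [div_eq_mul_inv, mul_inv]
    ring
  · rw [hL]
    generalize qPoch (t₂ / μ₁) q s = X1 at *
    generalize qPoch (-t₁) q s = X2 at *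
    generalize qPoch (q * μ₂ / t₂) q s = X3 at *
    generalize qPoch (-μ₂) q s = X4 at *
    generalize qPoch (-1 / μ₂) q s = X5 at *
    generalize qPoch (-q / μ₁) q s = X6 at *
    generalize qPoch (t₁ / μ₁) q s = X7 at *
    generalize qPoch q q s = X8 at *
    generalize qPochInf (q * q ^ s) q = Y1 at *
    generalize qPochInf (-q / μ₂) q = Y2 at *
    generalize qPochInf (-μ₂ * q ^ s) q = Y3 at *
    generalize qPochInf (-μ₁) q = Y4 at *
    generalize qPochInf (-t₁ * q ^ s) q = Y5 at *
    generalize qPochInf (-t₂) q = Y6 at *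
    generalize qPochInf (t₁ / μ₂) q = Y7 at *
    generalize qPochInf (t₂ / μ₂) q = Y8 at *
    generalize qPochInf (t₁ / μ₁ * q ^ s) q = Y9 at *
    generalize qPochInf (t₂ / μ₁ * q ^ s) q = Y10 at *
    generalize qPochInf (-q / μ₁ * q ^ s) q = Y11 at *
    generalize q ^ s = Q at *
    field_simp

end

/-! ### Biorthogonality within each branch. -/

section
variable {q μ₁ μ₂ t₁ t₂ : ℂ}

lemma hasBilateral_pos_pos_of_le (G : Generic q μ₁ μ₂ t₁ t₂) {s s' : ℕ} (hss : s' ≤ s) :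
    HasBilateral q μ₂ (fun y => rPos q μ₁ μ₂ t₁ (q ^ s) y * rPos q μ₁ μ₂ t₂ (q ^ s') y *
      wPos q μ₂ t₁ t₂ y) (if s = s' then normPos q μ₁ μ₂ t₁ t₂ (q ^ s) else 0) := by
  have hq := G.q_ne
  have h2 := G.t₂_ne
  have hμ₂ := G.μ₂_ne
  have hpow : ∀ n : ℕ, q ^ n ≠ 0 := fun n => pow_ne_zero _ hq
  have hsum := HasBilateral.sum (s := Finset.range (s' + 1)) fun k _ =>
    HasBilateral.sum (s := Finset.range (k + 1)) fun l _ =>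
      (hasBilateral_rPos_mul_ratio G s l).const_mul (coeff q μ₁ t₂ s' k * connCoeff q μ₂ t₂ k l)
  have hv : (if s = s' then normPos q μ₁ μ₂ t₁ t₂ (q ^ s) else 0) =
      ∑ k ∈ Finset.range (s' + 1), ∑ l ∈ Finset.range (k + 1),
        coeff q μ₁ t₂ s' k * connCoeff q μ₂ t₂ k l *
      ((-t₂ / q) ^ l * aaIntegral q (-μ₂ * q ^ l) 1 (t₁ / μ₂) (t₂ / μ₂ / q ^ l) *
        (qPoch (q ^ l)⁻¹ q s * qPoch (-q / μ₁) q s /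
          (qPoch (-q / (t₁ * q ^ l)) q s * qPoch (t₁ / μ₁) q s))) := by
    split_ifs with h
    · subst h
      rw [Finset.sum_eq_single s, Finset.sum_eq_single s, normPos_eq G]
      · intro l hl hne
        rw [qPoch_inv_pow_eq_zero hq (by have := Finset.mem_range.1 hl; omega)]
        simp
      · simp
      · intro k hk hne
        refine Finset.sum_eq_zero fun l hl => ?_
        rw [qPoch_inv_pow_eq_zero hq
          (by have := Finset.mem_range.1 hl; have := Finset.mem_range.1 hk; omega)]
        simp
      · simp
    · symm
      refine Finset.sum_eq_zero fun k hk => Finset.sum_eq_zero fun l hl => ?_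
      rw [qPoch_inv_pow_eq_zero hq
        (by have := Finset.mem_range.1 hl; have := Finset.mem_range.1 hk; omega)]
      simp
  rw [← hv] at hsum
  -- The connection formula fails at poles, so it is used only at grid points, where genericity of
  -- `t₂` excludes them.
  have hE : ∀ y : ℂ, y ≠ 0 → (∀ n : ℕ, q * μ₂ / t₂ / y * q ^ n ≠ 1) →
      rPos q μ₁ μ₂ t₁ (q ^ s) y * rPos q μ₁ μ₂ t₂ (q ^ s') y * wPos q μ₂ t₁ t₂ y =
      ∑ k ∈ Finset.range (s' + 1), ∑ l ∈ Finset.range (k + 1),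
        coeff q μ₁ t₂ s' k * connCoeff q μ₂ t₂ k l *
      (rPos q μ₁ μ₂ t₁ (q ^ s) y * ratio q (-μ₂) (q * μ₂ / t₂) l y * wPos q μ₂ t₁ t₂ y) := by
    intro y hy hB
    rw [rPos_pow hq μ₁ μ₂ t₂, Finset.mul_sum, Finset.sum_mul]
    refine Finset.sum_congr rfl fun k _ => ?_
    rw [ratio_one_eq_sum G k hy hB, Finset.mul_sum, Finset.mul_sum, Finset.sum_mul]
    exact Finset.sum_congr rfl fun l _ => by ring
  refine hsum.congr (fun n => hE _ (hpow n) fun m e => G.swap.t₁_μ₂ (m + 1 - n) ?_)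
    (fun n => hE _ (mul_ne_zero (neg_ne_zero.2 hμ₂) (hpow n)) fun m e => G.t₂_neg (m + 1 - n) ?_)
  · have := hpow n
    rw [zpow_sub₀ hq]; norm_cast
    field_simp at e ⊢
    linear_combination -e
  · have := hpow n
    rw [zpow_sub₀ hq]; norm_cast
    field_simp at e ⊢
    linear_combination -e

/-- Biorthogonality on the positive branch. -/
theorem hasBilateral_pos_pos (G : Generic q μ₁ μ₂ t₁ t₂) (s s' : ℕ) :
    HasBilateral q μ₂ (fun y => rPos q μ₁ μ₂ t₁ (q ^ s) y * rPos q μ₁ μ₂ t₂ (q ^ s') y *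
      wPos q μ₂ t₁ t₂ y) (if s = s' then normPos q μ₁ μ₂ t₁ t₂ (q ^ s) else 0) := by
  rcases le_total s' s with h | h
  · exact hasBilateral_pos_pos_of_le G h
  · have h1 := hasBilateral_pos_pos_of_le G.swap h
    have hv : (if s' = s then normPos q μ₁ μ₂ t₂ t₁ (q ^ s') else 0) =
        if s = s' then normPos q μ₁ μ₂ t₁ t₂ (q ^ s) else 0 := by
      by_cases hs : s = s'
      · subst hs
        rw [if_pos rfl, if_pos rfl, normPos_swap]
      · rw [if_neg hs, if_neg (Ne.symm hs)]
    rw [hv] at h1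
    refine h1.congr (fun n => ?_) (fun n => ?_) <;> simp only [wPos] <;> ring

/-- Biorthogonality on the negative branch. -/
theorem hasBilateral_neg_neg (G : Generic q μ₁ μ₂ t₁ t₂) (s s' : ℕ) :
    HasBilateral q μ₂ (fun y => rNeg q μ₁ μ₂ t₂ (-μ₁ * q ^ s) y * rNeg q μ₁ μ₂ t₁ (-μ₁ * q ^ s') y *
      (qPochInf (q * y) q * qPochInf (-q * y / μ₂) q /
        (qPochInf (-y / t₁) q * qPochInf (-y / t₂) q)))
      (μ₂ * if s = s' then normPos q μ₁⁻¹ μ₂⁻¹ t₂⁻¹ t₁⁻¹ (q ^ s) else 0) := by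
  refine HasBilateral.of_comp G.μ₂_ne ?_
  have hμ₂ := G.μ₂_ne
  have hE : ∀ y : ℂ, rNeg q μ₁ μ₂ t₂ (-μ₁ * q ^ s) (-μ₂ * y) *
      rNeg q μ₁ μ₂ t₁ (-μ₁ * q ^ s') (-μ₂ * y) *
      (qPochInf (q * (-μ₂ * y)) q * qPochInf (-q * (-μ₂ * y) / μ₂) q /
        (qPochInf (-(-μ₂ * y) / t₁) q * qPochInf (-(-μ₂ * y) / t₂) q)) =
      rPos q μ₁⁻¹ μ₂⁻¹ t₂⁻¹ (q ^ s) y * rPos q μ₁⁻¹ μ₂⁻¹ t₁⁻¹ (q ^ s') y *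
        wPos q μ₂⁻¹ t₂⁻¹ t₁⁻¹ y := by
    intro y
    rw [rNeg_eq_rPos G.μ₁_ne hμ₂, rNeg_eq_rPos G.μ₁_ne hμ₂, wPos,
      show q * (-μ₂ * y) = -q * y / μ₂⁻¹ by rw [div_inv_eq_mul]; ring,
      show -q * (-μ₂ * y) / μ₂ = q * y by field_simp,
      show -(-μ₂ * y) / t₁ = t₁⁻¹ * y / μ₂⁻¹ by rw [div_inv_eq_mul]; ring,
      show -(-μ₂ * y) / t₂ = t₂⁻¹ * y / μ₂⁻¹ by rw [div_inv_eq_mul]; ring,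
      mul_comm (qPochInf (-q * y / μ₂⁻¹) q), mul_comm (qPochInf (t₁⁻¹ * y / μ₂⁻¹) q)]
  exact (hasBilateral_pos_pos G.inv s s').congr (fun n => hE _) (fun n => hE _)

/-- The squared norm on the negative branch, with complex parameters. -/
def normNeg (q μ₁ μ₂ t₁ t₂ x : ℂ) : ℂ :=
  qPochInf q q * qPochInf q q * qPochInf (-μ₁) q * qPochInf (-μ₂) q *
      qPochInf (-q / μ₁) q * qPochInf (-q / μ₂) q /
    (qPochInf (-1 / t₁) q * qPochInf (-1 / t₂) q * qPochInf (μ₁ / t₁) q * qPochInf (μ₁ / t₂) q *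
      qPochInf (μ₂ / t₁) q * qPochInf (μ₂ / t₂) q) *
  (qPochInf (-x / t₁) q * qPochInf (-x / t₂) q /
    (qPochInf (q * x) q * qPochInf (-q * x / μ₁) q)) * (-x)⁻¹

/-- Both norms agree factor by factor except for the theta products: `(-μ, -q/μ;q)_∞ = μ (-1/μ,
-qμ;q)_∞`. For `μ₁` the extra factor cancels against `|x|⁻¹`; for `μ₂` it is the Jacobian of `y ↦
-μ₂y`. -/
lemma normNeg_eq (hq : ‖q‖ < 1) (hμ₁ : μ₁ ≠ 0) (hμ₂ : μ₂ ≠ 0) (x : ℂ) :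
    normNeg q μ₁ μ₂ t₁ t₂ (-μ₁ * x) = μ₂ * normPos q μ₁⁻¹ μ₂⁻¹ t₂⁻¹ t₁⁻¹ x := by
  have hθ : ∀ μ : ℂ, μ ≠ 0 → qPochInf (-μ) q * qPochInf (-q / μ) q =
      μ * (qPochInf (-μ⁻¹) q * qPochInf (-q / μ⁻¹) q) := by
    intro μ hμ
    rw [qPochInf_eq_mul_one hq (-μ), qPochInf_eq_mul_one hq (-μ⁻¹),
      show -μ⁻¹ * q = -q / μ by ring, show -q / μ⁻¹ = -μ * q by rw [div_inv_eq_mul]; ring]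
    have : 1 - -μ = μ * (1 - -μ⁻¹) := by field_simp; ring
    rw [this]
    ring
  have e1 := hθ μ₁ hμ₁
  have e2 := hθ μ₂ hμ₂
  rw [normNeg, normPos,
    show qPochInf q q * qPochInf q q * qPochInf (-μ₁) q * qPochInf (-μ₂) q *
      qPochInf (-q / μ₁) q * qPochInf (-q / μ₂) q = qPochInf q q * qPochInf q q *
      (qPochInf (-μ₁) q * qPochInf (-q / μ₁) q) * (qPochInf (-μ₂) q * qPochInf (-q / μ₂) q) by ring,
    e1, e2, show -1 / t₁ = -t₁⁻¹ by ring, show -1 / t₂ = -t₂⁻¹ by ring,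
    show μ₁ / t₁ = t₁⁻¹ / μ₁⁻¹ by rw [div_inv_eq_mul]; ring,
    show μ₁ / t₂ = t₂⁻¹ / μ₁⁻¹ by rw [div_inv_eq_mul]; ring,
    show μ₂ / t₁ = t₁⁻¹ / μ₂⁻¹ by rw [div_inv_eq_mul]; ring,
    show μ₂ / t₂ = t₂⁻¹ / μ₂⁻¹ by rw [div_inv_eq_mul]; ring,
    show -(-μ₁ * x) / t₁ = t₁⁻¹ * x / μ₁⁻¹ by rw [div_inv_eq_mul]; ring,
    show -(-μ₁ * x) / t₂ = t₂⁻¹ * x / μ₁⁻¹ by rw [div_inv_eq_mul]; ring,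
    show q * (-μ₁ * x) = -q * x / μ₁⁻¹ by rw [div_inv_eq_mul]; ring,
    show -q * (-μ₁ * x) / μ₁ = q * x by field_simp,
    show (-(-μ₁ * x))⁻¹ = μ₁⁻¹ * x⁻¹ by rw [neg_mul, neg_neg, mul_inv]]
  have hone : ∀ L R : ℂ, L = R * (μ₁ * μ₁⁻¹) → L = R :=
    fun L R h => by rw [h, mul_inv_cancel₀ hμ₁, mul_one]
  apply hone
  generalize qPochInf (-q / μ₁⁻¹) q = A1
  generalize qPochInf (-q / μ₂⁻¹) q = A2
  generalize qPochInf (t₁⁻¹ / μ₁⁻¹) q = A3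
  generalize qPochInf (t₂⁻¹ / μ₁⁻¹) q = A4
  generalize qPochInf (t₁⁻¹ / μ₂⁻¹) q = A5
  generalize qPochInf (t₂⁻¹ / μ₂⁻¹) q = A6
  generalize qPochInf (t₁⁻¹ * x / μ₁⁻¹) q = A7
  generalize qPochInf (t₂⁻¹ * x / μ₁⁻¹) q = A8
  generalize qPochInf (-q * x / μ₁⁻¹) q = A9
  simp only [div_eq_mul_inv, mul_inv]
  ring

end

/-! ### Back to real arguments -/

lemma HasBilateral.jackson {q μ : ℝ} {F : ℝ → ℂ} {f : ℂ → ℂ} {v : ℂ}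
    (h : HasBilateral q μ f v) (hF : ∀ y : ℝ, F y = f y) :
    JacksonIntegrable q F (-μ) 1 ∧ jackson q F (-μ) 1 = (1 - (q : ℂ)) * v := by
  obtain ⟨A, B, hA, hB, rfl⟩ := h
  have hA' : HasSum (fun k : ℕ => F (1 * q ^ k) * ((q ^ k : ℝ) : ℂ)) A := by
    simpa [hF] using hA
  have hB' : HasSum (fun k : ℕ => F (-μ * q ^ k) * ((q ^ k : ℝ) : ℂ)) B := by
    simpa [hF] using hB
  refine ⟨⟨hB'.summable, hA'.summable⟩, ?_⟩
  rw [QBiorth.jackson, jacksonZero, jacksonZero, hA'.tsum_eq, hB'.tsum_eq]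
  push_cast
  ring

end QBiorth

end

theorem mainTheorem5 (q μ₁ μ₂ : ℝ) (hq0 : 0 < q) (hq1 : q < 1) (hμ₁ : 0 < μ₁) (hμ₂ : 0 < μ₂)
    (t₁ t₂ : ℂ) (ht : t₁ * t₂ = (μ₁ : ℂ) * (μ₂ : ℂ))
    (hgen : ∀ m : ℤ, t₁ ≠ (μ₁ : ℂ) * (q : ℂ) ^ m ∧ t₁ ≠ (μ₂ : ℂ) * (q : ℂ) ^ m ∧
      t₁ ≠ -(q : ℂ) ^ m ∧ t₂ ≠ -(q : ℂ) ^ m) :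
    (∀ x y : ℝ, QBiorth.uPos q μ₁ μ₂ t₁ x y = QBiorth.uPos q μ₂ μ₁ t₁ y x ∧
      QBiorth.uNeg q μ₁ μ₂ t₂ x y = QBiorth.uNeg q μ₂ μ₁ t₂ y x) ∧
    ∀ x ∈ QBiorth.grid q μ₁, ∀ x' ∈ QBiorth.grid q μ₁,
      QBiorth.JacksonIntegrable q
        (fun y => QBiorth.u q μ₁ μ₂ t₁ t₂ x y * QBiorth.v q μ₁ μ₂ t₁ t₂ x' y *
          QBiorth.weight q μ₂ t₁ t₂ x x' y) (-μ₂) 1 ∧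
      QBiorth.jackson q
        (fun y => QBiorth.u q μ₁ μ₂ t₁ t₂ x y * QBiorth.v q μ₁ μ₂ t₁ t₂ x' y *
          QBiorth.weight q μ₂ t₁ t₂ x x' y) (-μ₂) 1 =
        (1 - (q : ℂ)) * QBiorth.normSq q μ₁ μ₂ t₁ t₂ x * (if x = x' then 1 else 0) := by
  open QBiorth in
  refine ⟨fun x y => ⟨?_, ?_⟩, ?_⟩
  · unfold uPos phi32
    exact tsum_congr fun k => by ring
  · unfold uNeg phi32
    exact tsum_congr fun k => by ring
  have hneg : ∀ {μ : ℝ}, 0 < μ → ∀ m : ℤ, (μ : ℂ) ≠ -(q : ℂ) ^ m := fun {μ} hμ m h => by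
    have h1 : μ = -q ^ m := by exact_mod_cast h
    have := zpow_pos hq0 m
    linarith
  have G : Generic (q : ℂ) μ₁ μ₂ t₁ t₂ :=
    { q_ne := by exact_mod_cast hq0.ne'
      q_lt := by rwa [Complex.norm_real, Real.norm_of_nonneg hq0.le]
      μ₁_ne := by exact_mod_cast hμ₁.ne'
      μ₂_ne := by exact_mod_cast hμ₂.ne'
      prod := ht
      t₁_μ₁ := fun m => (hgen m).1
      t₁_μ₂ := fun m => (hgen m).2.1
      t₁_neg := fun m => (hgen m).2.2.1
      t₂_neg := fun m => (hgen m).2.2.2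
      μ₁_neg := hneg hμ₁
      μ₂_neg := hneg hμ₂ }
  have hpos : ∀ s : ℕ, 0 < q ^ s := fun s => pow_pos hq0 s
  have hnp : ∀ s : ℕ, ¬ 0 < -μ₁ * q ^ s := fun s h => by
    have := mul_pos hμ₁ (hpos s)
    linarith
  have hinj : ∀ s s' : ℕ, q ^ s = q ^ s' ↔ s = s' := fun s s' =>
    (pow_right_injective₀ hq0 hq1.ne).eq_iff
  have huPos : ∀ (t : ℂ) (s : ℕ) (y : ℝ), uPos q μ₁ μ₂ t (q ^ s) y = rPos q μ₁ μ₂ t ((q : ℂ) ^ s) y :=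
    fun t s y => by rw [uPos, rPos]; push_cast; rfl
  have huNeg : ∀ (t : ℂ) (s : ℕ) (y : ℝ), uNeg q μ₁ μ₂ t (-μ₁ * q ^ s) y =
      rNeg q μ₁ μ₂ t (-μ₁ * (q : ℂ) ^ s) y :=
    fun t s y => by rw [uNeg, rNeg]; push_cast; rfl
  have hne : ∀ s s' : ℕ, q ^ s ≠ -μ₁ * q ^ s' := fun s s' h => hnp s' (h ▸ hpos s)
  rintro x ⟨s, rfl | rfl⟩ x' ⟨s', rfl | rfl⟩
  · refine ((hasBilateral_pos_pos G s s').jackson fun y => ?_).imp_right fun h => h.trans ?_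
    · simp only [u, v, weight, if_pos (hpos _), huPos, wPos]
    · simp only [normSq, if_pos (hpos s), hinj, normPos, abs_of_pos (hpos s)]
      push_cast
      split_ifs <;> ring
  · refine ((hasBilateral_pos_neg G s s').jackson fun y => ?_).imp_right fun h => h.trans ?_
    · simp only [u, v, weight, if_pos (hpos _), if_neg (hnp _), huPos, huNeg]
    · rw [if_neg (hne s s')]
      simp
  -- With `x < 0 < x'` both functions involve `t₂`, so this is the mixed case with `t₁`, `t₂` and
  -- the two factors interchanged.
  · refine ((hasBilateral_pos_neg G.swap s' s).jackson fun y => ?_).imp_right fun h => h.trans ?_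
    · simp only [u, v, weight, if_pos (hpos _), if_neg (hnp _), huPos, huNeg]
      ring
    · rw [if_neg (hne s' s).symm]
      simp
  · refine ((hasBilateral_neg_neg G s s').jackson fun y => ?_).imp_right fun h => h.trans ?_
    · simp only [u, v, weight, if_neg (hnp _), huNeg]
    · have hμ : (-μ₁ * q ^ s = -μ₁ * q ^ s') ↔ s = s' := by
        rw [mul_right_inj' (neg_ne_zero.2 hμ₁.ne'), hinj]
      have habs : |(-μ₁ * q ^ s)| = -(-μ₁ * q ^ s) := abs_of_nonpos (not_lt.1 (hnp s))
      have hN : normSq q μ₁ μ₂ t₁ t₂ (-μ₁ * q ^ s) =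
          normNeg q μ₁ μ₂ t₁ t₂ (-μ₁ * (q : ℂ) ^ s) := by
        rw [normSq, if_neg (hnp s), normNeg, habs]
        push_cast
        rfl
      rw [hN, normNeg_eq G.q_lt G.μ₁_ne G.μ₂_ne]
      simp only [hμ]
      split_ifs <;> ring
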